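/- Let $T>0$, $\mu\in\mathbb R$, $D:=(0,1)$, $\lambda_k:=k\pi$, $\varepsilon_k(x):=\sqrt2\sin(\lambda_kx)$ and $\varphi_k(x):=\sqrt2\cos(\lambda_kx)$ for integers $k\ge1$. Let $\kappa\ge1$ be an integer such that $\kappa^2\pi^2>\mu$. Then there exists a constant $C>0$, depending only on $T$, $\mu$ and $\kappa$, such that the following holds. Let $W$ be a space-time white noise on $[0,T]\times D$ over a probability space $(\Omega,\mathcal F,P)$, that is, a centred Gaussian process $(W(A))$ indexed by the Borel sets $A\subseteq[0,T]\times D$ with $\mathbb E[W(A)W(B)]=|A\cap B|$; deterministic square integrable functions are integrated against $dW$ in the sense of the Wiener integral. Let $u$ be the mild solution of $$u_t+u_{xxxx}+\mu\,u_{xx}=\partial_x\dot W\ \text{ in }(0,T]\times D,\qquad u=u_{xx}=0\ \text{ at }x\in\{0,1\},\qquad u(0,\cdot)=0,$$ that is, a random field, measurable in $(\omega,x)$ for each $t$, such that for all $(t,x)\in[0,T]\times[0,1]$, almost surely, $$u(t,x)=\int_0^t\!\int_D\Psi_{t-s}(x,y)\,dW(s,y),\qquad \Psi_t(x,y):=-\sum_{k=1}^\infty\lambda_k\,e^{-\lambda_k^2(\lambda_k^2-\mu)t}\,\varepsilon_k(x)\,\varphi_k(y).$$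 Let $\mathsf N\ge1$ and $\mathsf M\ge\kappa$ be integers, $\Delta t:=T/\mathsf N$, $t_n:=n\,\Delta t$ and $\mathsf T_n:=(t_{n-1},t_n)$ for $n=1,\dots,\mathsf N$. Define the load $$\mathcal W(t,x):=\frac1{\Delta t}\sum_{i=1}^{\mathsf M}R^n_i\,\varphi_i(x)\quad\text{for }t\in\mathsf T_n,\ x\in D,\qquad R^n_i:=\int_{\mathsf T_n}\!\int_D\varphi_i(x)\,dW(t,x),$$ and let $\mathsf u$ be, almost surely, the solution of the canvas problem $$\mathsf u_t+\mathsf u_{xxxx}+\mu\,\mathsf u_{xx}=\partial_x\mathcal W\ \text{ in }\mathsf T_n\times D,\ n=1,\dots,\mathsf N,\qquad \mathsf u=\mathsf u_{xx}=0\ \text{ at }x\in\{0,1\}\text{ for }t\in(0,T],\qquad \mathsf u(0,\cdot)=0\ \text{ in }D,$$ with $\mathsf u$ continuous on $[0,T]\times[0,1]$ and its $x$-derivatives up to order four continuous on $(0,T]\times[0,1]$. Then the function $t\mapsto\big(\mathbb E\,\|u(t,\cdot)-\mathsf u(t,\cdot)\|_{L^2(D)}^2\big)^{1/2}$ attains its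 maximum on $[0,T]$ and $$\max_{t\in[0,T]}\Big(\mathbb E\,\|u(t,\cdot)-\mathsf u(t,\cdot)\|_{L^2(D)}^2\Big)^{1/2}\le C\,\big(\Delta t^{1/8}+\mathsf M^{-1/2}\big).$$ -/

import Mathlib

open MeasureTheory ProbabilityTheory Set
open scoped ENNReal

noncomputable section

namespace CahnHilliardCook

/-! ### Space-time white noise and its Wiener integral -/

/-- The space-time domain `[0,T] × D` with `D = (0,1)`; points are pairs `(time, space)`. -/
def spaceTime (T : ℝ) : Set (ℝ × ℝ) := Icc 0 T ×ˢ Ioo 0 1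

/-- Lebesgue measure on `[0,T] × D`. -/
def spaceTimeMeasure (T : ℝ) : Measure (ℝ × ℝ) := volume.restrict (spaceTime T)

/-- The Borel subsets of `[0,T] × D`. -/
abbrev BorelPart (T : ℝ) : Type := {A : Set (ℝ × ℝ) // MeasurableSet A ∧ A ⊆ spaceTime T}

/-- Space-time white noise on `[0,T] × D`: a centred Gaussian process indexed by the Borel subsets
of `[0,T] × D`, the covariance of `W A` and `W B` being the Lebesgue measure of `A ∩ B`. -/
structure IsWhiteNoise {Ω : Type*} [MeasurableSpace Ω] (T : ℝ) (P : Measure Ω)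
    (W : BorelPart T → Ω → ℝ) : Prop where
  gaussian : IsGaussianProcess W P
  mean_zero : ∀ A, ∫ ω, W A ω ∂P = 0
  covariance : ∀ A B, ∫ ω, W A ω * W B ω ∂P = (volume (A.1 ∩ B.1)).toReal

/-- The simple function `∑ a_j 1_{A_j}` attached to a finite family of coefficients. -/
def simpleFn {T : ℝ} (c : BorelPart T →₀ ℝ) (p : ℝ × ℝ) : ℝ :=
  c.sum fun A a => A.1.indicator (fun _ => a) p

/-- The stochastic integral `∑ a_j W(A_j)` of the simple function `∑ a_j 1_{A_j}`. -/
def simpleIntegral {Ω : Type*} {T : ℝ} (W : BorelPart T → Ω → ℝ) (c : BorelPart T →₀ ℝ)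
    (ω : Ω) : ℝ :=
  c.sum fun A a => a * W A ω

/-- `X` is (a version of) the Wiener integral `∬ f dW` of the deterministic square integrable `f`:
`f` and `X` can be approximated simultaneously, in `L²([0,T] × D)` and in `L²(P)`, by a simple
function and its stochastic integral. -/
def IsWienerIntegral {Ω : Type*} [MeasurableSpace Ω] {T : ℝ} (P : Measure Ω)
    (W : BorelPart T → Ω → ℝ) (f : ℝ × ℝ → ℝ) (X : Ω → ℝ) : Prop :=
  MemLp f 2 (spaceTimeMeasure T) ∧ MemLp X 2 P ∧
    ∀ ε : ℝ≥0∞, 0 < ε → ∃ c : BorelPart T →₀ ℝ,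
      eLpNorm (f - simpleFn c) 2 (spaceTimeMeasure T) < ε ∧
        eLpNorm (X - simpleIntegral W c) 2 P < ε

open Classical in
/-- The Wiener integral `∬_{[0,T] × D} f dW`, determined up to almost sure equality; see
`IsWhiteNoise.isWienerIntegral` and `IsWhiteNoise.wienerIntegral_unique`. -/
def wienerIntegral {Ω : Type*} [MeasurableSpace Ω] {T : ℝ} (P : Measure Ω)
    (W : BorelPart T → Ω → ℝ) (f : ℝ × ℝ → ℝ) : Ω → ℝ :=
  if h : ∃ X, IsWienerIntegral P W f X then h.choose else 0

section WellDefined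

variable {Ω : Type*} [MeasurableSpace Ω] {T : ℝ} {P : Measure Ω} {W : BorelPart T → Ω → ℝ}

theorem spaceTimeMeasure_ne_top (A : BorelPart T) : spaceTimeMeasure T A.1 ≠ ∞ := by
  have h : volume (spaceTime T) < ∞ := by
    rw [spaceTime, Measure.volume_eq_prod, Measure.prod_prod]
    exact ENNReal.mul_lt_top (by simp) (by simp)
  exact ((Measure.restrict_apply_le _ _).trans_lt ((measure_mono A.2.2).trans_lt h)).ne

/-- The linear map sending a family of coefficients to the class of its simple function. -/
def simpleFnLp (T : ℝ) : (BorelPart T →₀ ℝ) →ₗ[ℝ] Lp ℝ 2 (spaceTimeMeasure T) :=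
  Finsupp.linearCombination ℝ fun A : BorelPart T =>
    indicatorConstLp 2 A.2.1 (spaceTimeMeasure_ne_top A) (1 : ℝ)

theorem IsWhiteNoise.memLp (hW : IsWhiteNoise T P W) (A : BorelPart T) : MemLp (W A) 2 P :=
  (hW.gaussian.hasGaussianLaw_eval A).memLp_two

/-- The linear map sending a family of coefficients to the class of its stochastic integral. -/
def IsWhiteNoise.simpleIntegralLp (hW : IsWhiteNoise T P W) :
    (BorelPart T →₀ ℝ) →ₗ[ℝ] Lp ℝ 2 P :=
  Finsupp.linearCombination ℝ fun A : BorelPart T => (hW.memLp A).toLp (W A)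

theorem coeFn_simpleFnLp (c : BorelPart T →₀ ℝ) :
    simpleFnLp T c =ᵐ[spaceTimeMeasure T] simpleFn c := by
  induction c using Finsupp.induction_linear with
  | zero =>
    rw [map_zero]
    filter_upwards [Lp.coeFn_zero ℝ 2 (spaceTimeMeasure T)] with p hp
    rw [hp]; simp [simpleFn]
  | add c d hc hd =>
    rw [map_add]
    filter_upwards [Lp.coeFn_add (simpleFnLp T c) (simpleFnLp T d), hc, hd] with p hp h1 h2
    rw [hp, Pi.add_apply, h1, h2, simpleFn, simpleFn, simpleFn, Finsupp.sum_add_index']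
    · intro A; simp
    · intro A a b; simp only [Set.indicator]; split_ifs <;> simp
  | single A a =>
    rw [simpleFnLp, Finsupp.linearCombination_single]
    filter_upwards [Lp.coeFn_smul a
      (indicatorConstLp 2 A.2.1 (spaceTimeMeasure_ne_top A) (1 : ℝ)),
      indicatorConstLp_coeFn (p := 2) (hs := A.2.1) (hμs := spaceTimeMeasure_ne_top A)
        (c := (1 : ℝ))] with p hp h1
    rw [hp, Pi.smul_apply, h1, simpleFn, Finsupp.sum_single_index (by simp)]
    simp only [Set.indicator]; split_ifs <;> simp

theorem IsWhiteNoise.coeFn_simpleIntegralLp (hW : IsWhiteNoise T P W) (c : BorelPart T →₀ ℝ) :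
    hW.simpleIntegralLp c =ᵐ[P] simpleIntegral W c := by
  induction c using Finsupp.induction_linear with
  | zero =>
    rw [map_zero]
    filter_upwards [Lp.coeFn_zero ℝ 2 P] with p hp
    rw [hp]; simp [simpleIntegral]
  | add c d hc hd =>
    rw [map_add]
    filter_upwards [Lp.coeFn_add (hW.simpleIntegralLp c) (hW.simpleIntegralLp d), hc, hd]
      with p hp h1 h2
    rw [hp, Pi.add_apply, h1, h2, simpleIntegral, simpleIntegral, simpleIntegral,
      Finsupp.sum_add_index']
    · intro A; simp
    · intro A a b; ring
  | single A a =>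
    rw [IsWhiteNoise.simpleIntegralLp, Finsupp.linearCombination_single]
    filter_upwards [Lp.coeFn_smul a ((hW.memLp A).toLp (W A)), (hW.memLp A).coeFn_toLp]
      with p hp h1
    rw [hp, Pi.smul_apply, h1, simpleIntegral, Finsupp.sum_single_index (by simp)]
    simp

theorem IsWhiteNoise.norm_simpleIntegralLp (hW : IsWhiteNoise T P W) (c : BorelPart T →₀ ℝ) :
    ‖hW.simpleIntegralLp c‖ = ‖simpleFnLp T c‖ := by
  have key : ∀ A B : BorelPart T,
      inner ℝ ((hW.memLp A).toLp (W A)) ((hW.memLp B).toLp (W B)) =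
        inner ℝ (indicatorConstLp 2 A.2.1 (spaceTimeMeasure_ne_top A) (1 : ℝ))
          (indicatorConstLp 2 B.2.1 (spaceTimeMeasure_ne_top B) (1 : ℝ)) := by
    intro A B
    rw [L2.inner_indicatorConstLp_indicatorConstLp A.2.1 B.2.1
      (spaceTimeMeasure_ne_top A) (spaceTimeMeasure_ne_top B), L2.inner_def]
    have h1 : ∫ ω, inner ℝ ((hW.memLp A).toLp (W A) ω) ((hW.memLp B).toLp (W B) ω) ∂P =
        ∫ ω, W A ω * W B ω ∂P := by
      refine integral_congr_ae ?_
      filter_upwards [(hW.memLp A).coeFn_toLp, (hW.memLp B).coeFn_toLp] with ω ha hb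
      rw [ha, hb]; simp [mul_comm]
    rw [h1, hW.covariance, measureReal_def, spaceTimeMeasure,
      Measure.restrict_eq_self _ (inter_subset_left.trans A.2.2)]
    simp
  have hsq : inner ℝ (hW.simpleIntegralLp c) (hW.simpleIntegralLp c) =
      inner ℝ (simpleFnLp T c) (simpleFnLp T c) := by
    simp only [IsWhiteNoise.simpleIntegralLp, simpleFnLp, Finsupp.linearCombination_apply,
      Finsupp.sum, sum_inner, inner_sum,
      real_inner_smul_left, real_inner_smul_right, key]
  rw [real_inner_self_eq_norm_sq, real_inner_self_eq_norm_sq] at hsq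
  exact (sq_eq_sq₀ (norm_nonneg _) (norm_nonneg _)).1 hsq

theorem denseRange_simpleFnLp (T : ℝ) : DenseRange (simpleFnLp T) := by
  intro g
  rw [← LinearMap.coe_range, ← Submodule.topologicalClosure_coe]
  refine Lp.induction (by simp) (motive := fun g =>
    g ∈ ((LinearMap.range (simpleFnLp T)).topologicalClosure : Set _)) ?_ ?_ ?_ g
  · intro a s hs hμs
    refine Submodule.le_topologicalClosure _ ?_
    have hQ : MeasurableSet (spaceTime T) := measurableSet_Icc.prod measurableSet_Ioo
    let A : BorelPart T := ⟨s ∩ spaceTime T, hs.inter hQ, inter_subset_right⟩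
    refine ⟨Finsupp.single A a, Lp.ext ?_⟩
    rw [Lp.simpleFunc.coe_indicatorConst]
    filter_upwards [coeFn_simpleFnLp (Finsupp.single A a),
      indicatorConstLp_coeFn (p := 2) (hs := hs) (hμs := hμs.ne) (c := a),
      ae_restrict_mem (μ := volume) hQ] with p h1 h2 h3
    rw [h1, h2, simpleFn, Finsupp.sum_single_index (by simp)]
    by_cases h4 : p ∈ s
    · rw [indicator_of_mem h4, indicator_of_mem (show p ∈ A.1 from ⟨h4, h3⟩)]
    · rw [indicator_of_notMem h4, indicator_of_notMem (show p ∉ A.1 from fun h => h4 h.1)]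
  · intro f g hf hg _ h1 h2
    exact Submodule.add_mem _ h1 h2
  · exact Submodule.isClosed_topologicalClosure _

theorem eLpNorm_sub_eq_edist {α : Type*} [MeasurableSpace α] {m : Measure α} {f g : α → ℝ}
    {F G : Lp ℝ 2 m} (hf : F =ᵐ[m] f) (hg : G =ᵐ[m] g) :
    eLpNorm (f - g) 2 m = edist F G := by
  rw [Lp.edist_def]
  exact eLpNorm_congr_ae (hf.symm.sub hg.symm)

/-- Every square integrable function has a Wiener integral. -/
theorem IsWhiteNoise.exists_isWienerIntegral (hW : IsWhiteNoise T P W) {f : ℝ × ℝ → ℝ}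
    (hf : MemLp f 2 (spaceTimeMeasure T)) : ∃ X, IsWienerIntegral P W f X := by
  have hd := denseRange_simpleFnLp T
  have hb : ∀ c, ‖hW.simpleIntegralLp c‖ ≤ 1 * ‖simpleFnLp T c‖ := fun c => by
    rw [one_mul, hW.norm_simpleIntegralLp]
  set F := hW.simpleIntegralLp.extendOfNorm (simpleFnLp T) with hF
  refine ⟨F (hf.toLp f), hf, Lp.memLp _, fun ε hε => ?_⟩
  obtain ⟨_, ⟨c, rfl⟩, hg⟩ := Metric.mem_closure_iff.1 (hd (hf.toLp f)) (min ε 1).toReal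
    (ENNReal.toReal_pos (by simp [hε.ne']) (by simp))
  have hlt : edist (hf.toLp f) (simpleFnLp T c) < ε := by
    rw [edist_dist]
    refine lt_of_lt_of_le ((ENNReal.ofReal_lt_iff_lt_toReal dist_nonneg (by simp)).2 hg)
      (min_le_left _ _)
  refine ⟨c, ?_, ?_⟩
  · rwa [eLpNorm_sub_eq_edist hf.coeFn_toLp (coeFn_simpleFnLp c)]
  · rw [eLpNorm_sub_eq_edist (F := F (hf.toLp f)) (G := hW.simpleIntegralLp c)
      Filter.EventuallyEq.rfl (hW.coeFn_simpleIntegralLp c)]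
    refine lt_of_le_of_lt ?_ hlt
    rw [← LinearMap.extendOfNorm_eq hd ⟨1, hb⟩ c, edist_dist, edist_dist, dist_eq_norm,
      dist_eq_norm, ← map_sub]
    refine ENNReal.ofReal_le_ofReal ?_
    simpa using LinearMap.norm_extendOfNorm_apply_le hd 1 hb (hf.toLp f - simpleFnLp T c)

/-- For white noise and square integrable `f`, `wienerIntegral P W f` is a Wiener integral. -/
theorem IsWhiteNoise.isWienerIntegral (hW : IsWhiteNoise T P W) {f : ℝ × ℝ → ℝ}
    (hf : MemLp f 2 (spaceTimeMeasure T)) : IsWienerIntegral P W f (wienerIntegral P W f) := by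
  have h := hW.exists_isWienerIntegral hf
  rw [wienerIntegral, dif_pos h]
  exact h.choose_spec

/-- The Wiener integral is unique up to almost sure equality. -/
theorem IsWhiteNoise.wienerIntegral_unique (hW : IsWhiteNoise T P W) {f : ℝ × ℝ → ℝ}
    {X Y : Ω → ℝ} (hX : IsWienerIntegral P W f X) (hY : IsWienerIntegral P W f Y) :
    X =ᵐ[P] Y := by
  obtain ⟨hf, hX2, hX⟩ := hX
  obtain ⟨_, hY2, hY⟩ := hY
  rw [← MemLp.toLp_eq_toLp_iff hX2 hY2]
  refine edist_le_zero.1 (le_of_forall_pos_le_add fun ε hε => ?_)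
  rw [zero_add]
  have hε4 : 0 < ε / 4 := ENNReal.div_pos hε.ne' (by simp)
  obtain ⟨c, hc1, hc2⟩ := hX _ hε4
  obtain ⟨d, hd1, hd2⟩ := hY _ hε4
  rw [eLpNorm_sub_eq_edist hf.coeFn_toLp (coeFn_simpleFnLp _)] at hc1 hd1
  rw [eLpNorm_sub_eq_edist hX2.coeFn_toLp (hW.coeFn_simpleIntegralLp _)] at hc2
  rw [eLpNorm_sub_eq_edist hY2.coeFn_toLp (hW.coeFn_simpleIntegralLp _)] at hd2
  have hcd : edist (hW.simpleIntegralLp c) (hW.simpleIntegralLp d) ≤ ε / 4 + ε / 4 := by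
    have : edist (hW.simpleIntegralLp c) (hW.simpleIntegralLp d) =
        edist (simpleFnLp T c) (simpleFnLp T d) := by
      rw [edist_dist, edist_dist, dist_eq_norm, dist_eq_norm, ← map_sub, ← map_sub,
        hW.norm_simpleIntegralLp]
    rw [this]
    exact (edist_triangle_left _ _ _).trans (add_le_add hc1.le hd1.le)
  calc _ ≤ edist (hX2.toLp X) (hW.simpleIntegralLp c) +
        edist (hW.simpleIntegralLp c) (hW.simpleIntegralLp d) +
        edist (hW.simpleIntegralLp d) (hY2.toLp Y) := edist_triangle4 _ _ _ _
    _ ≤ ε / 4 + (ε / 4 + ε / 4) + ε / 4 := by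
        gcongr
        rw [edist_comm]; exact hd2.le
    _ = 4 * (ε / 4) := by ring
    _ = ε := ENNReal.mul_div_cancel (by simp) (by simp)

end WellDefined

/-! ### The mild solution -/

/-- `λ_k = k π`. -/
def lam (k : ℕ) : ℝ := k * Real.pi

/-- `ε_k(x) = √2 sin(λ_k x)`. -/
def sineMode (k : ℕ) (x : ℝ) : ℝ := √2 * Real.sin (lam k * x)

/-- `φ_k(x) = √2 cos(λ_k x)`. -/
def cosMode (k : ℕ) (x : ℝ) : ℝ := √2 * Real.cos (lam k * x)

/-- `Ψ_t(x,y) = -∑_{k ≥ 1} λ_k exp(-λ_k² (λ_k² - μ) t) ε_k(x) φ_k(y)`, for `t > 0`. -/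
def mildKernel (μ t x y : ℝ) : ℝ :=
  -∑' k : ℕ, lam (k + 1) * Real.exp (-(lam (k + 1)) ^ 2 * ((lam (k + 1)) ^ 2 - μ) * t) *
    sineMode (k + 1) x * cosMode (k + 1) y

/-- `u` is the mild solution of `u_t + u_xxxx + μ u_xx = ∂ₓ Ẇ` on `[0,T] × D` with
`u = u_xx = 0` at `x = 0, 1` and `u(0,·) = 0`, that is, a random field with
`u(t,x) = ∫₀ᵗ ∫_D Ψ_{t-s}(x,y) dW(s,y)` almost surely, for all `(t,x) ∈ [0,T] × [0,1]`. -/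
structure IsMildSolution {Ω : Type*} [MeasurableSpace Ω] {T : ℝ} (μ : ℝ) (P : Measure Ω)
    (W : BorelPart T → Ω → ℝ) (u : Ω → ℝ → ℝ → ℝ) : Prop where
  measurable : ∀ t ∈ Icc 0 T,
    AEStronglyMeasurable (fun q : Ω × ℝ => u q.1 t q.2) (P.prod (volume.restrict (Ioo 0 1)))
  eq_integral : ∀ t ∈ Icc 0 T, ∀ x ∈ Icc (0 : ℝ) 1, (fun ω => u ω t x) =ᵐ[P]
    wienerIntegral P W (fun p => (Ioo 0 t).indicator (fun s => mildKernel μ (t - s) x p.2) p.1)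

/-! ### The canvas problem -/

/-- The time slab `T_n = (t_{n-1}, t_n)`, where `t_n = n Δt` and `Δt = T / N`. -/
def timeSlab (T : ℝ) (N n : ℕ) : Set ℝ := Ioo (((n : ℝ) - 1) * (T / N)) (n * (T / N))

/-- `R_i^n = ∫_{T_n} ∫_D φ_i(x) dW(t,x)`. -/
def modeIncrement {Ω : Type*} [MeasurableSpace Ω] {T : ℝ} (P : Measure Ω)
    (W : BorelPart T → Ω → ℝ) (N n i : ℕ) : Ω → ℝ :=
  wienerIntegral P W fun p => (timeSlab T N n).indicator (fun _ => cosMode i p.2) p.1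

/-- The canvas load `𝒲(t,x) = (1/Δt) ∑_{i=1}^M R_i^n φ_i(x)` for `t ∈ T_n`, `n = 1, …, N`
(with the immaterial value `0` for the remaining `t`). -/
def canvasLoad {Ω : Type*} [MeasurableSpace Ω] {T : ℝ} (P : Measure Ω)
    (W : BorelPart T → Ω → ℝ) (N M : ℕ) (ω : Ω) (t x : ℝ) : ℝ :=
  ∑ n ∈ Finset.Icc 1 N, (timeSlab T N n).indicator
    (fun _ => 1 / (T / N) * ∑ i ∈ Finset.Icc 1 M, modeIncrement P W N n i ω * cosMode i x) t

/-- The spatial derivative `∂ₓ^j v(t,x)` on `[0,1]`, one-sided at the end points. -/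
def spatialDeriv (j : ℕ) (v : ℝ → ℝ → ℝ) (t x : ℝ) : ℝ :=
  iteratedDerivWithin j (v t) (Icc 0 1) x

/-- `v` is the solution of `v_t + v_xxxx + μ v_xx = ∂ₓ g` with `v = v_xx = 0` at `x = 0, 1` and
`v(0,·) = 0`, where the load `g` is piecewise constant in time: `v` is continuous on
`[0,T] × [0,1]`, its spatial derivatives up to order four are continuous on `(0,T] × [0,1]`, and
the equation holds in each `T_n × D`. -/
structure IsCanvasSolution (T μ : ℝ) (N : ℕ) (g v : ℝ → ℝ → ℝ) : Prop where
  continuousOn : ContinuousOn (fun p : ℝ × ℝ => v p.1 p.2) (Icc 0 T ×ˢ Icc 0 1)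
  contDiffOn : ∀ t ∈ Ioc 0 T, ContDiffOn ℝ 4 (v t) (Icc 0 1)
  continuousOn_spatialDeriv : ∀ j ≤ 4,
    ContinuousOn (fun p : ℝ × ℝ => spatialDeriv j v p.1 p.2) (Ioc 0 T ×ˢ Icc 0 1)
  boundary : ∀ t ∈ Ioc 0 T, ∀ x ∈ ({0, 1} : Set ℝ), v t x = 0 ∧ spatialDeriv 2 v t x = 0
  initial : ∀ x ∈ Ioo (0 : ℝ) 1, v 0 x = 0
  equation : ∀ n ∈ Finset.Icc 1 N, ∀ t ∈ timeSlab T N n, ∀ x ∈ Ioo (0 : ℝ) 1,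
    DifferentiableAt ℝ (fun s => v s x) t ∧
      deriv (fun s => v s x) t + spatialDeriv 4 v t x + μ * spatialDeriv 2 v t x =
        deriv (g t) x

/-! ### The error -/

/-- `Θ(t) = (E ‖u(t,·) - v(t,·)‖²_{L²(D)})^{1/2}`, as an extended nonnegative number. -/
def meanSquareError {Ω : Type*} [MeasurableSpace Ω] (P : Measure Ω) (u v : Ω → ℝ → ℝ → ℝ)
    (t : ℝ) : ℝ≥0∞ :=
  (∫⁻ ω, (∫⁻ x in Ioo (0 : ℝ) 1, ENNReal.ofReal ((u ω t x - v ω t x) ^ 2)) ∂P) ^ (1 / 2 : ℝ)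

end CahnHilliardCook

end

noncomputable section

namespace CahnHilliardCook

/-! ### Linearity and isometry of the Wiener integral -/

/-! Everything is diagonal in the sine and cosine modes. The canvas problem is solved by a
trigonometric polynomial whose coefficients are Duhamel integrals of the piecewise constant noise
(`isCanvasSolution_sum`), and an energy argument shows that any other solution agrees with it
(`IsCanvasSolution.ae_eq`). In mode k ≤ M, discretising the noise thus amounts to replacing the
propagator s ↦ 1_{(0,t)}(s) exp(-λ_k²(λ_k²-μ)(t-s)) by its means over the time slabs; modes k > M
are dropped.

The error at (t,x) is therefore a single Wiener integral. The Itô isometry, Parseval in y and the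
normalisation of ε_k in x give the exact formula `meanSquareError_eq`: the squared error is Σ λ_k²
V_k(t), where V_k is the squared L²(0,T) distance of the propagator from its projection (from 0 if k
> M).

Two bounds on V_k carry the rate. Projection does not increase the norm, so V_k ≤ C k⁻⁴
(`exists_integral_propagator_sq_le`); the role of κ is that the rates grow like k⁴ from κ on. For k
≤ M, the propagator is monotone up to one jump and bounded uniformly in k, so V_k ≤ C Δt
(`modeVariance_le_step`). Hence the terms are at most a constant times min(k² Δt, k⁻²). Splitting at
k ≈ Δt^(-1/4) gives Δt^(1/4), the tail k > M gives 1/M, and the square root gives the claim. The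
maximum is attained because the series is a uniform limit of continuous functions on [0,T]. -/

theorem simpleIntegral_add {Ω : Type*} {T : ℝ} (W : BorelPart T → Ω → ℝ) (c d : BorelPart T →₀ ℝ) :
    simpleIntegral W (c + d) = simpleIntegral W c + simpleIntegral W d := by
  ext ω
  rw [Pi.add_apply, simpleIntegral, simpleIntegral, simpleIntegral, Finsupp.sum_add_index']
  · intro A; simp
  · intro A a b; ring

theorem simpleIntegral_smul {Ω : Type*} {T : ℝ} (W : BorelPart T → Ω → ℝ) (a : ℝ) (c : BorelPart T →₀ ℝ) :
    simpleIntegral W (a • c) = a • simpleIntegral W c := by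
  ext ω
  rw [Pi.smul_apply, simpleIntegral, simpleIntegral, Finsupp.sum_smul_index (by simp),
    Finsupp.smul_sum]
  refine Finset.sum_congr rfl fun A _ => ?_
  simp [mul_assoc]

section WienerIntegral

variable {Ω : Type*} [MeasurableSpace Ω] {T : ℝ} {P : Measure Ω} {W : BorelPart T → Ω → ℝ}

theorem simpleFn_add (c d : BorelPart T →₀ ℝ) : simpleFn (c + d) = simpleFn c + simpleFn d := by
  ext p
  rw [Pi.add_apply, simpleFn, simpleFn, simpleFn, Finsupp.sum_add_index']
  · intro A; simp
  · intro A a b; simp only [Set.indicator]; split_ifs <;> simp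

theorem simpleFn_smul (a : ℝ) (c : BorelPart T →₀ ℝ) : simpleFn (a • c) = a • simpleFn c := by
  ext p
  rw [Pi.smul_apply, simpleFn, simpleFn, Finsupp.sum_smul_index (by simp), Finsupp.smul_sum]
  refine Finset.sum_congr rfl fun A _ => ?_
  simp only [Set.indicator]; split_ifs <;> simp

theorem memLp_simpleFn (c : BorelPart T →₀ ℝ) : MemLp (simpleFn c) 2 (spaceTimeMeasure T) :=
  (memLp_congr_ae (coeFn_simpleFnLp c)).1 (Lp.memLp _)

theorem IsWhiteNoise.memLp_simpleIntegral (hW : IsWhiteNoise T P W) (c : BorelPart T →₀ ℝ) :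
    MemLp (simpleIntegral W c) 2 P :=
  (memLp_congr_ae (hW.coeFn_simpleIntegralLp c)).1 (Lp.memLp _)

theorem IsWhiteNoise.eLpNorm_simpleIntegral (hW : IsWhiteNoise T P W) (c : BorelPart T →₀ ℝ) :
    eLpNorm (simpleIntegral W c) 2 P = eLpNorm (simpleFn c) 2 (spaceTimeMeasure T) := by
  rw [← eLpNorm_congr_ae (hW.coeFn_simpleIntegralLp c), ← eLpNorm_congr_ae (coeFn_simpleFnLp c),
    ← Lp.enorm_def, ← Lp.enorm_def, ← ofReal_norm, ← ofReal_norm, hW.norm_simpleIntegralLp]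

theorem IsWienerIntegral.add (hW : IsWhiteNoise T P W) {f g : ℝ × ℝ → ℝ} {X Y : Ω → ℝ}
    (hX : IsWienerIntegral P W f X) (hY : IsWienerIntegral P W g Y) :
    IsWienerIntegral P W (f + g) (X + Y) := by
  obtain ⟨hf, hX2, hX⟩ := hX
  obtain ⟨hg, hY2, hY⟩ := hY
  refine ⟨hf.add hg, hX2.add hY2, fun ε hε => ?_⟩
  have hε2 : 0 < ε / 2 := ENNReal.half_pos hε.ne'
  obtain ⟨c, hc1, hc2⟩ := hX _ hε2
  obtain ⟨d, hd1, hd2⟩ := hY _ hε2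
  refine ⟨c + d, ?_, ?_⟩
  · rw [simpleFn_add, add_sub_add_comm, ← ENNReal.add_halves ε]
    exact (eLpNorm_add_le (hf.sub (memLp_simpleFn c)).1 (hg.sub (memLp_simpleFn d)).1
      one_le_two).trans_lt (ENNReal.add_lt_add hc1 hd1)
  · rw [simpleIntegral_add, add_sub_add_comm, ← ENNReal.add_halves ε]
    exact (eLpNorm_add_le (hX2.sub (hW.memLp_simpleIntegral c)).1
      (hY2.sub (hW.memLp_simpleIntegral d)).1 one_le_two).trans_lt (ENNReal.add_lt_add hc2 hd2)

theorem IsWienerIntegral.smul (a : ℝ) {f : ℝ × ℝ → ℝ} {X : Ω → ℝ}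
    (hX : IsWienerIntegral P W f X) : IsWienerIntegral P W (a • f) (a • X) := by
  obtain ⟨hf, hX2, hX⟩ := hX
  refine ⟨hf.const_smul a, hX2.const_smul a, fun ε hε => ?_⟩
  have ha : ‖a‖ₑ + 1 ≠ ∞ := by simp
  have key : ∀ x : ℝ≥0∞, x < ε / (‖a‖ₑ + 1) → ‖a‖ₑ * x < ε := fun x hx => by
    rw [ENNReal.lt_div_iff_mul_lt (by simp) (by simp), mul_comm] at hx
    exact lt_of_le_of_lt (by gcongr; exact le_self_add) hx
  -- Dividing by |a| + 1 instead of |a| covers a = 0 as well.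
  obtain ⟨c, hc1, hc2⟩ := hX _ (ENNReal.div_pos hε.ne' ha)
  refine ⟨a • c, ?_, ?_⟩
  · rw [simpleFn_smul, ← smul_sub, eLpNorm_const_smul]
    exact key _ hc1
  · rw [simpleIntegral_smul, ← smul_sub, eLpNorm_const_smul]
    exact key _ hc2

theorem IsWienerIntegral.zero : IsWienerIntegral P W 0 0 :=
  ⟨MemLp.zero', MemLp.zero', fun ε hε => ⟨0, by
    have h1 : simpleFn (0 : BorelPart T →₀ ℝ) = 0 := by ext; simp [simpleFn]
    have h2 : simpleIntegral W (0 : BorelPart T →₀ ℝ) = 0 := by ext; simp [simpleIntegral]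
    simpa [h1, h2] using hε⟩⟩

theorem IsWienerIntegral.sub (hW : IsWhiteNoise T P W) {f g : ℝ × ℝ → ℝ} {X Y : Ω → ℝ}
    (hX : IsWienerIntegral P W f X) (hY : IsWienerIntegral P W g Y) :
    IsWienerIntegral P W (f - g) (X - Y) := by
  have h := hX.add hW (hY.smul (-1))
  simpa [sub_eq_add_neg] using h

theorem IsWienerIntegral.sum (hW : IsWhiteNoise T P W) {ι : Type*} (s : Finset ι)
    {f : ι → ℝ × ℝ → ℝ} {X : ι → Ω → ℝ} (h : ∀ i ∈ s, IsWienerIntegral P W (f i) (X i)) :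
    IsWienerIntegral P W (∑ i ∈ s, f i) (∑ i ∈ s, X i) := by
  classical
  induction s using Finset.induction_on with
  | empty => simpa using IsWienerIntegral.zero
  | insert i s hi ih =>
    rw [Finset.sum_insert hi, Finset.sum_insert hi]
    exact (h i (by simp)).add hW (ih fun j hj => h j (by simp [hj]))

/-- The Itô isometry. -/
theorem IsWienerIntegral.eLpNorm_eq (hW : IsWhiteNoise T P W) {f : ℝ × ℝ → ℝ} {X : Ω → ℝ}
    (hX : IsWienerIntegral P W f X) : eLpNorm X 2 P = eLpNorm f 2 (spaceTimeMeasure T) := by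
  obtain ⟨hf, hX2, hX⟩ := hX
  -- Each inequality passes through a simple function, where the two norms coincide by the
  -- covariance; the two approximation errors cost ε/2 each.
  refine le_antisymm (le_of_forall_pos_le_add fun ε hε => ?_)
    (le_of_forall_pos_le_add fun ε hε => ?_) <;>
  obtain ⟨c, hc1, hc2⟩ := hX _ (ENNReal.half_pos hε.ne')
  · have h1 : eLpNorm X 2 P ≤ eLpNorm (X - simpleIntegral W c) 2 P +
        eLpNorm (simpleIntegral W c) 2 P := by
      simpa using eLpNorm_add_le (hX2.sub (hW.memLp_simpleIntegral c)).1
        (hW.memLp_simpleIntegral c).1 one_le_two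
    have h2 : eLpNorm (simpleFn c) 2 (spaceTimeMeasure T) ≤
        eLpNorm f 2 (spaceTimeMeasure T) + eLpNorm (f - simpleFn c) 2 (spaceTimeMeasure T) := by
      simpa using eLpNorm_sub_le hf.1 (hf.sub (memLp_simpleFn c)).1 one_le_two
    rw [hW.eLpNorm_simpleIntegral] at h1
    calc _ ≤ ε / 2 + (eLpNorm f 2 (spaceTimeMeasure T) + ε / 2) :=
          h1.trans (add_le_add hc2.le (h2.trans (by gcongr)))
      _ = _ := by rw [add_left_comm, ENNReal.add_halves]
  · have h1 : eLpNorm f 2 (spaceTimeMeasure T) ≤ eLpNorm (f - simpleFn c) 2 (spaceTimeMeasure T) +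
        eLpNorm (simpleFn c) 2 (spaceTimeMeasure T) := by
      simpa using eLpNorm_add_le (hf.sub (memLp_simpleFn c)).1 (memLp_simpleFn c).1 one_le_two
    have h2 : eLpNorm (simpleIntegral W c) 2 P ≤
        eLpNorm X 2 P + eLpNorm (X - simpleIntegral W c) 2 P := by
      simpa using eLpNorm_sub_le hX2.1 (hX2.sub (hW.memLp_simpleIntegral c)).1 one_le_two
    rw [← hW.eLpNorm_simpleIntegral] at h1
    calc _ ≤ ε / 2 + (eLpNorm X 2 P + ε / 2) :=
          h1.trans (add_le_add hc1.le (h2.trans (by gcongr)))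
      _ = _ := by rw [add_left_comm, ENNReal.add_halves]

end WienerIntegral

/-! ### Uniqueness for the canvas problem -/

section Uniqueness

variable {T μ : ℝ} {N : ℕ}

theorem timeSlab_subset (hT : 0 < T) {n : ℕ} (hn : n ∈ Finset.Icc 1 N) :
    timeSlab T N n ⊆ Ioo 0 T := by
  rw [Finset.mem_Icc] at hn
  have h1 : (1 : ℝ) ≤ n := by exact_mod_cast hn.1
  have h2 : (n : ℝ) ≤ N := by exact_mod_cast hn.2
  have hN : (0 : ℝ) < N := by linarith
  refine Ioo_subset_Ioo (by have := div_pos hT hN; nlinarith) ?_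
  rw [mul_div_assoc', div_le_iff₀ hN]
  nlinarith

theorem uniqueDiffOn_unit : UniqueDiffOn ℝ (Icc (0 : ℝ) 1) := uniqueDiffOn_Icc zero_lt_one

/-- An interior point has [0,1] as a neighbourhood, so the derivative within the interval is a
genuine one, as the fundamental theorem of calculus requires. -/
theorem hasDerivAt_iteratedDerivWithin_unit {f : ℝ → ℝ} (hf : ContDiffOn ℝ 4 f (Icc 0 1)) {j : ℕ}
    (hj : j < 4) {x : ℝ} (hx : x ∈ Ioo (0 : ℝ) 1) :
    HasDerivAt (iteratedDerivWithin j f (Icc 0 1))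
      (iteratedDerivWithin (j + 1) f (Icc 0 1) x) x := by
  have h1 := hf.differentiableOn_iteratedDerivWithin (m := j) (by exact_mod_cast hj)
    uniqueDiffOn_unit x (Ioo_subset_Icc_self hx)
  rw [iteratedDerivWithin_succ]
  exact h1.hasDerivWithinAt.hasDerivAt (Icc_mem_nhds hx.1 hx.2)

/-- Two integrations by parts against the fourth derivative. -/
theorem integral_mul_iteratedDerivWithin_four {f : ℝ → ℝ} (hf : ContDiffOn ℝ 4 f (Icc 0 1))
    (h0 : ∀ x ∈ ({0, 1} : Set ℝ), f x = 0 ∧ iteratedDerivWithin 2 f (Icc 0 1) x = 0) :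
    ∫ x in Ioo (0 : ℝ) 1, (f x * iteratedDerivWithin 4 f (Icc 0 1) x -
      iteratedDerivWithin 2 f (Icc 0 1) x ^ 2) = 0 := by
  have hc : ∀ j ≤ 4, ContinuousOn (iteratedDerivWithin j f (Icc 0 1)) (Icc 0 1) := fun j hj =>
    hf.continuousOn_iteratedDerivWithin (by exact_mod_cast hj) uniqueDiffOn_unit
  have hf0 := hf.continuousOn
  rw [← integral_Ioc_eq_integral_Ioo, ← intervalIntegral.integral_of_le zero_le_one,
    -- The antiderivative f f''' - f' f'' vanishes at both ends because f and f'' do.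
    intervalIntegral.integral_eq_sub_of_hasDerivAt_of_le (f := fun x =>
      f x * iteratedDerivWithin 3 f (Icc 0 1) x -
      iteratedDerivWithin 1 f (Icc 0 1) x * iteratedDerivWithin 2 f (Icc 0 1) x) zero_le_one]
  · simp [h0 0, h0 1]
  · exact (hf0.mul (hc 3 (by norm_num))).sub ((hc 1 (by norm_num)).mul (hc 2 (by norm_num)))
  · intro x hx
    have e0 := hasDerivAt_iteratedDerivWithin_unit hf (j := 0) (by norm_num) hx
    have e1 := hasDerivAt_iteratedDerivWithin_unit hf (j := 1) (by norm_num) hx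
    have e2 := hasDerivAt_iteratedDerivWithin_unit hf (j := 2) (by norm_num) hx
    have e3 := hasDerivAt_iteratedDerivWithin_unit hf (j := 3) (by norm_num) hx
    rw [iteratedDerivWithin_zero] at e0
    refine ((e0.mul e3).sub (e1.mul e2)).congr_deriv ?_
    simp only [zero_add, Nat.reduceAdd]
    ring
  · refine ContinuousOn.intervalIntegrable_of_Icc zero_le_one ?_
    exact (hf0.mul (hc 4 le_rfl)).sub ((hc 2 (by norm_num)).pow 2)

/-- By linearity the load cancels, which reduces uniqueness to the homogeneous problem. -/
theorem IsCanvasSolution.sub (hT : 0 < T) {g v w : ℝ → ℝ → ℝ} (hv : IsCanvasSolution T μ N g v)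
    (hw : IsCanvasSolution T μ N g w) :
    IsCanvasSolution T μ N 0 (fun t x => v t x - w t x) := by
  have key : ∀ j ≤ 4, ∀ t ∈ Ioc 0 T, ∀ x ∈ Icc (0 : ℝ) 1,
      spatialDeriv j (fun t x => v t x - w t x) t x =
        spatialDeriv j v t x - spatialDeriv j w t x := fun j hj t ht x hx =>
    iteratedDerivWithin_sub hx uniqueDiffOn_unit
      ((hv.contDiffOn t ht x hx).of_le (by exact_mod_cast hj))
      ((hw.contDiffOn t ht x hx).of_le (by exact_mod_cast hj))
  refine ⟨hv.continuousOn.sub hw.continuousOn,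
    fun t ht => (hv.contDiffOn t ht).sub (hw.contDiffOn t ht), fun j hj => ?_, fun t ht x hx => ?_,
    fun x hx => ?_, fun n hn t ht x hx => ?_⟩
  · exact ((hv.continuousOn_spatialDeriv j hj).sub (hw.continuousOn_spatialDeriv j hj)).congr
      fun p hp => key j hj p.1 hp.1 p.2 hp.2
  · have hx' : x ∈ Icc (0 : ℝ) 1 := by rcases hx with rfl | rfl <;> simp
    rw [key 2 (by norm_num) t ht x hx', (hv.boundary t ht x hx).1, (hv.boundary t ht x hx).2,
      (hw.boundary t ht x hx).1, (hw.boundary t ht x hx).2]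
    simp
  · rw [hv.initial x hx, hw.initial x hx, sub_zero]
  · obtain ⟨d1, e1⟩ := hv.equation n hn t ht x hx
    obtain ⟨d2, e2⟩ := hw.equation n hn t ht x hx
    have ht' : t ∈ Ioc 0 T := Ioo_subset_Ioc_self (timeSlab_subset hT hn ht)
    have hx' := Ioo_subset_Icc_self hx
    refine ⟨d1.sub d2, ?_⟩
    rw [key 4 le_rfl t ht' x hx', key 2 (by norm_num) t ht' x hx', deriv_fun_sub d1 d2]
    simp only [Pi.zero_apply]
    rw [show deriv (0 : ℝ → ℝ) x = 0 by simp]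
    linarith

/-- The energy `∫ w(t,x)² dx`. -/
def energy (w : ℝ → ℝ → ℝ) (t : ℝ) : ℝ := ∫ x in Ioo (0 : ℝ) 1, w t x ^ 2

theorem energy_nonneg (w : ℝ → ℝ → ℝ) (t : ℝ) : 0 ≤ energy w t :=
  setIntegral_nonneg measurableSet_Ioo fun _ _ => sq_nonneg _

theorem integrableOn_unit {f : ℝ → ℝ} (hf : ContinuousOn f (Icc 0 1)) :
    IntegrableOn f (Ioo 0 1) :=
  hf.integrableOn_Icc.mono_set Ioo_subset_Icc_self

theorem ContinuousOn.section_right {X : Type*} [TopologicalSpace X] {f : ℝ × ℝ → X} {s t : Set ℝ}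
    (hf : ContinuousOn f (s ×ˢ t)) {a : ℝ} (ha : a ∈ s) : ContinuousOn (fun x => f (a, x)) t :=
  hf.comp (by fun_prop) fun _ hx => ⟨ha, hx⟩

/-- The equation says nothing at the slab end points; continuity of the energy is what carries
information from one slab to the next. -/
theorem IsCanvasSolution.continuousOn_energy {g w : ℝ → ℝ → ℝ} (hw : IsCanvasSolution T μ N g w) :
    ContinuousOn (energy w) (Icc 0 T) := by
  obtain ⟨K, hK⟩ := (isCompact_Icc.prod isCompact_Icc).exists_bound_of_continuousOn
    (hw.continuousOn.pow 2)
  refine continuousOn_of_dominated (bound := fun _ => K) (fun t ht => ?_) (fun t ht => ?_)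
    (by simp) ?_
  · exact (integrableOn_unit
      (ContinuousOn.section_right hw.continuousOn ht |>.pow 2)).aestronglyMeasurable
  · filter_upwards [ae_restrict_mem measurableSet_Ioo] with x hx
    exact hK (t, x) ⟨ht, Ioo_subset_Icc_self hx⟩
  · filter_upwards [ae_restrict_mem measurableSet_Ioo] with x hx
    exact ContinuousOn.pow (hw.continuousOn.comp (f := fun t => (t, x)) (by fun_prop)
      fun t ht => ⟨ht, Ioo_subset_Icc_self hx⟩) 2

/-- No continuity of the time derivative is assumed: the equation expresses it through spatial
derivatives, which are continuous and so bounded on a compact neighbourhood inside the slab times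
[0,1]. This supplies the dominating constant. -/
theorem IsCanvasSolution.hasDerivAt_energy (hT : 0 < T) {w : ℝ → ℝ → ℝ}
    (hw : IsCanvasSolution T μ N 0 w) {n : ℕ} (hn : n ∈ Finset.Icc 1 N) {t : ℝ}
    (ht : t ∈ timeSlab T N n) :
    HasDerivAt (energy w) (∫ x in Ioo (0 : ℝ) 1,
      2 * w t x * -(spatialDeriv 4 w t x + μ * spatialDeriv 2 w t x)) t := by
  obtain ⟨ε, hε, hball⟩ := Metric.nhds_basis_closedBall.mem_iff.1 (isOpen_Ioo.mem_nhds ht)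
  have hsub : Metric.closedBall t ε ⊆ Ioc 0 T := fun s hs =>
    Ioo_subset_Ioc_self (timeSlab_subset hT hn (hball hs))
  have hF : ContinuousOn (fun p : ℝ × ℝ =>
      2 * w p.1 p.2 * -(spatialDeriv 4 w p.1 p.2 + μ * spatialDeriv 2 w p.1 p.2))
      (Ioc 0 T ×ˢ Icc 0 1) :=
    (continuousOn_const.mul (hw.continuousOn.mono (prod_mono_left Ioc_subset_Icc_self))).mul
      ((hw.continuousOn_spatialDeriv 4 le_rfl).add
        (continuousOn_const.mul (hw.continuousOn_spatialDeriv 2 (by norm_num)))).neg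
  obtain ⟨K, hK⟩ := ((isCompact_closedBall t ε).prod (isCompact_Icc (a := (0 : ℝ)) (b := 1))
    ).exists_bound_of_continuousOn (hF.mono (prod_mono_left hsub))
  have htT : t ∈ Ioc 0 T := hsub (Metric.mem_closedBall_self hε.le)
  have hsq : ∀ s ∈ Metric.closedBall t ε, IntegrableOn (fun x => w s x ^ 2) (Ioo 0 1) :=
    fun s hs => integrableOn_unit (ContinuousOn.section_right hw.continuousOn
      (Ioc_subset_Icc_self (hsub hs)) |>.pow 2)
  refine (hasDerivAt_integral_of_dominated_loc_of_deriv_le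
    (bound := fun _ => K) (F := fun s x => w s x ^ 2) (Metric.closedBall_mem_nhds t hε) ?_
    (hsq t (Metric.mem_closedBall_self hε.le))
    (F' := fun s x => 2 * w s x * -(spatialDeriv 4 w s x + μ * spatialDeriv 2 w s x))
    (integrableOn_unit (ContinuousOn.section_right hF htT)).aestronglyMeasurable
    ?_ (by simp) ?_).2
  · filter_upwards [Metric.closedBall_mem_nhds t hε] with s hs
    exact (hsq s hs).aestronglyMeasurable
  · filter_upwards [ae_restrict_mem measurableSet_Ioo] with x hx s hs
    exact hK (s, x) ⟨hs, Ioo_subset_Icc_self hx⟩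
  · filter_upwards [ae_restrict_mem measurableSet_Ioo] with x hx s hs
    obtain ⟨hd, he⟩ := hw.equation n hn s (hball hs) x hx
    simp only [Pi.zero_apply] at he
    rw [show deriv (0 : ℝ → ℝ) x = 0 by simp] at he
    refine (hd.hasDerivAt.pow 2).congr_deriv ?_
    rw [show deriv (fun s => w s x) s = -(spatialDeriv 4 w s x + μ * spatialDeriv 2 w s x) by
      linarith]
    simp

/-- After integration by parts the integrand is -2(w_xx² + μ w w_xx), and completing the square
bounds it by (μ²/2) w² pointwise. -/
theorem IsCanvasSolution.deriv_energy_le (hT : 0 < T) {w : ℝ → ℝ → ℝ}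
    (hw : IsCanvasSolution T μ N 0 w) {n : ℕ} (hn : n ∈ Finset.Icc 1 N) {t : ℝ}
    (ht : t ∈ timeSlab T N n) : deriv (energy w) t ≤ μ ^ 2 / 2 * energy w t := by
  have htT : t ∈ Ioc 0 T := Ioo_subset_Ioc_self (timeSlab_subset hT hn ht)
  have hc : ∀ j ≤ 4, ContinuousOn (spatialDeriv j w t) (Icc 0 1) := fun j hj =>
    ContinuousOn.section_right (hw.continuousOn_spatialDeriv j hj) htT
  have h0 : ContinuousOn (w t) (Icc 0 1) := (hw.contDiffOn t htT).continuousOn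
  have h4 := hc 4 le_rfl
  have h2 := hc 2 (by norm_num)
  rw [(hw.hasDerivAt_energy hT hn ht).deriv]
  have hparts := integral_mul_iteratedDerivWithin_four (hw.contDiffOn t htT) (hw.boundary t htT)
  change ∫ x in Ioo (0 : ℝ) 1, (w t x * spatialDeriv 4 w t x - spatialDeriv 2 w t x ^ 2) = 0
    at hparts
  have e : ∫ x in Ioo (0 : ℝ) 1, 2 * w t x * -(spatialDeriv 4 w t x + μ * spatialDeriv 2 w t x) =
      ∫ x in Ioo (0 : ℝ) 1, -2 * (spatialDeriv 2 w t x ^ 2 + μ * (w t x * spatialDeriv 2 w t x)) := by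
    rw [← sub_eq_zero, ← integral_sub]
    · have h := congrArg (fun r => -2 * r) hparts
      simp only [mul_zero, ← integral_const_mul] at h
      refine Eq.trans (integral_congr_ae (.of_forall fun x => ?_)) h
      ring
    · exact integrableOn_unit (by fun_prop)
    · exact integrableOn_unit (by fun_prop)
  rw [e, energy, ← integral_const_mul]
  refine setIntegral_mono (integrableOn_unit (by fun_prop)) (integrableOn_unit (by fun_prop))
    fun x => ?_
  nlinarith [sq_nonneg (2 * spatialDeriv 2 w t x + μ * w t x)]

/-- Grönwall's inequality on each slab, by induction on the slabs starting from the zero initial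
datum. -/
theorem IsCanvasSolution.energy_eq_zero (hT : 0 < T) (hN : 1 ≤ N) {w : ℝ → ℝ → ℝ}
    (hw : IsCanvasSolution T μ N 0 w) {t : ℝ} (ht : t ∈ Icc 0 T) : energy w t = 0 := by
  have hN' : (0 : ℝ) < N := by exact_mod_cast hN
  have hΔ : 0 < T / N := div_pos hT hN'
  suffices h : ∀ n ≤ N, ∀ t ∈ Icc 0 (n * (T / N)), energy w t = 0 by
    refine h N le_rfl t ?_
    rwa [mul_div_cancel₀ _ hN'.ne']
  intro n hn
  induction n with
  | zero =>
    intro t ht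
    have ht : t = 0 := by simpa using ht
    rw [energy, setIntegral_congr_fun (g := fun _ => (0 : ℝ)) measurableSet_Ioo, integral_zero]
    intro x hx
    simp [ht, hw.initial x hx]
  | succ n ih =>
    intro t ht
    rcases le_total t (n * (T / N)) with h | h
    · exact ih (by omega) t ⟨ht.1, h⟩
    have hmem : n + 1 ∈ Finset.Icc 1 N := by simp; omega
    have hslab : timeSlab T N (n + 1) = Ioo (n * (T / N)) ((n + 1 : ℕ) * (T / N)) := by
      simp [timeSlab]
    have hle : ((n + 1 : ℕ) : ℝ) * (T / N) ≤ T := by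
      have : ((n + 1 : ℕ) : ℝ) ≤ N := by exact_mod_cast hn
      calc _ ≤ (N : ℝ) * (T / N) := by gcongr
        _ = T := mul_div_cancel₀ _ hN'.ne'
    have hn0 : 0 ≤ n * (T / N) := by positivity
    have hder : ∀ s ∈ Ioo (n * (T / N)) ((n + 1 : ℕ) * (T / N)),
        HasDerivAt (fun s => Real.exp (-(μ ^ 2 / 2) * s) * energy w s)
          (Real.exp (-(μ ^ 2 / 2) * s) * -(μ ^ 2 / 2) * energy w s +
            Real.exp (-(μ ^ 2 / 2) * s) * deriv (energy w) s) s := fun s hs => by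
      have h1 := (hw.hasDerivAt_energy hT hmem (hslab ▸ hs)).differentiableAt.hasDerivAt
      exact (((hasDerivAt_id s).const_mul _).exp.congr_deriv (by simp)).mul h1
    -- The integrating factor makes the energy nonincreasing on the closed slab. It is zero at the
    -- left end by induction, and it is nonnegative.
    have hanti : AntitoneOn (fun s => Real.exp (-(μ ^ 2 / 2) * s) * energy w s)
        (Icc (n * (T / N)) ((n + 1 : ℕ) * (T / N))) := by
      refine antitoneOn_of_deriv_nonpos (convex_Icc _ _) ?_ ?_ ?_
      · refine ContinuousOn.mul (by fun_prop) (hw.continuousOn_energy.mono ?_)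
        exact Icc_subset_Icc hn0 hle
      · rw [interior_Icc]
        exact fun s hs => (hder s hs).differentiableAt.differentiableWithinAt
      · rw [interior_Icc]
        intro s hs
        rw [(hder s hs).deriv]
        have h2 := hw.deriv_energy_le hT hmem (hslab ▸ hs)
        have h3 := Real.exp_pos (-(μ ^ 2 / 2) * s)
        nlinarith
    have h1 := hanti ⟨le_rfl, h.trans ht.2⟩ ⟨h, ht.2⟩ h
    simp only [ih (by omega) _ ⟨hn0, le_rfl⟩, mul_zero] at h1
    exact le_antisymm (nonpos_of_mul_nonpos_right h1 (Real.exp_pos _)) (energy_nonneg w t)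

/-- Two solutions of the canvas problem with the same load agree. -/
theorem IsCanvasSolution.ae_eq (hT : 0 < T) (hN : 1 ≤ N) {g v w : ℝ → ℝ → ℝ}
    (hv : IsCanvasSolution T μ N g v) (hw : IsCanvasSolution T μ N g w) {t : ℝ}
    (ht : t ∈ Icc 0 T) : ∀ᵐ x ∂volume.restrict (Ioo (0 : ℝ) 1), v t x = w t x := by
  have hd := hv.sub hT hw
  have h := hd.energy_eq_zero hT hN ht
  rw [energy, integral_eq_zero_iff_of_nonneg (fun _ => sq_nonneg _)
    (integrableOn_unit (ContinuousOn.section_right hd.continuousOn ht |>.pow 2))] at h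
  filter_upwards [h] with x hx
  exact sub_eq_zero.1 (pow_eq_zero_iff two_ne_zero |>.1 hx)

end Uniqueness

/-! ### The explicit solution of the canvas problem -/

section Explicit

/-- The decay rate `λ_k² (λ_k² - μ)` of the `k`-th mode. -/
def rate (μ : ℝ) (k : ℕ) : ℝ := lam k ^ 2 * (lam k ^ 2 - μ)

/-- The propagator `1_{(0,t)}(s) exp(-λ_k² (λ_k² - μ) (t - s))` of the `k`-th mode. -/
def propagator (μ : ℝ) (k : ℕ) (t s : ℝ) : ℝ :=
  (Ioo 0 t).indicator (fun s => Real.exp (-rate μ k * (t - s))) s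

/-- The mean of `f` over the time slab `T_n`. -/
def slabMean (T : ℝ) (N : ℕ) (f : ℝ → ℝ) (n : ℕ) : ℝ := 1 / (T / N) * ∫ s in timeSlab T N n, f s

/-- The function which is equal to `ρ n` on `T_n`. -/
def slabStep (T : ℝ) (N : ℕ) (ρ : ℕ → ℝ) (t : ℝ) : ℝ :=
  ∑ n ∈ Finset.Icc 1 N, (timeSlab T N n).indicator (fun _ => ρ n) t

/-- The coefficient of the `i`-th mode of the solution of the canvas problem. -/
def canvasCoeff (T μ : ℝ) (N i : ℕ) (ρ : ℕ → ℝ) (t : ℝ) : ℝ :=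
  -lam i * ∑ n ∈ Finset.Icc 1 N, ρ n * slabMean T N (propagator μ i t) n

variable {T μ : ℝ} {N : ℕ}

theorem slabStep_of_mem (hT : 0 < T) (ρ : ℕ → ℝ) {n : ℕ} (hn : n ∈ Finset.Icc 1 N) {t : ℝ}
    (ht : t ∈ timeSlab T N n) : slabStep T N ρ t = ρ n := by
  have hN : 1 ≤ N := by rw [Finset.mem_Icc] at hn; omega
  have hΔ : 0 < T / N := div_pos hT (by exact_mod_cast hN)
  -- Disjointness of the slabs: a common point forces m - 1 < k, hence m ≤ k, and the roles may be
  -- exchanged.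
  have key : ∀ m k : ℕ, t ∈ timeSlab T N m → t ∈ timeSlab T N k → m ≤ k := fun m k hm hk => by
    have h : ((m : ℝ) - 1) < k := lt_of_mul_lt_mul_right (hm.1.trans hk.2) hΔ.le
    have : (m : ℝ) < (k + 1 : ℕ) := by push_cast; linarith
    have : m < k + 1 := by exact_mod_cast this
    omega
  rw [slabStep, Finset.sum_eq_single_of_mem n hn, indicator_of_mem ht]
  intro m _ hmn
  exact indicator_of_notMem (fun hm => hmn (le_antisymm (key _ _ hm ht) (key _ _ ht hm))) _

theorem measurableSet_timeSlab (T : ℝ) (N n : ℕ) : MeasurableSet (timeSlab T N n) :=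
  measurableSet_Ioo

theorem measurable_slabStep (T : ℝ) (N : ℕ) (ρ : ℕ → ℝ) : Measurable (slabStep T N ρ) :=
  Finset.measurable_fun_sum _ fun n _ => measurable_const.indicator (measurableSet_timeSlab T N n)

theorem integrable_slabStep (T : ℝ) (N : ℕ) (ρ : ℕ → ℝ) : Integrable (slabStep T N ρ) :=
  integrable_finsetSum _ fun n _ => (integrable_indicator_iff (measurableSet_timeSlab T N n)).2
    (integrableOn_const (by simp [timeSlab]))

theorem measurable_propagator (μ : ℝ) (k : ℕ) (t : ℝ) : Measurable (propagator μ k t) :=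
  (by fun_prop : Measurable fun s => Real.exp (-rate μ k * (t - s))).indicator measurableSet_Ioo

theorem integrable_propagator (μ : ℝ) (k : ℕ) (t : ℝ) : Integrable (propagator μ k t) := by
  refine (integrable_indicator_iff measurableSet_Ioo).2 ?_
  exact (Continuous.integrableOn_Icc (by fun_prop)).mono_set Ioo_subset_Icc_self

/-- The form with slab means is linear in ρ with deterministic weights, which suits the Wiener
integral; this Duhamel form, with the dependence on t pulled out of the integrand, is the one that
can be differentiated. -/
theorem canvasCoeff_eq_integral (i : ℕ) (ρ : ℕ → ℝ) {t : ℝ} (ht : 0 ≤ t) :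
    canvasCoeff T μ N i ρ t = -lam i * (Real.exp (-rate μ i * t) *
      ∫ s in (0 : ℝ)..t, Real.exp (rate μ i * s) *
        (1 / (T / N) * slabStep T N ρ s)) := by
  rw [canvasCoeff, intervalIntegral.integral_of_le ht, integral_Ioc_eq_integral_Ioo,
    ← integral_const_mul, ← integral_indicator measurableSet_Ioo]
  congr 1
  have h : ∀ s, (Ioo 0 t).indicator (fun s => Real.exp (-rate μ i * t) * (Real.exp (rate μ i * s) *
        (1 / (T / N) * slabStep T N ρ s))) s =
      ∑ n ∈ Finset.Icc 1 N, ρ n * (1 / (T / N) *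
        (timeSlab T N n).indicator (propagator μ i t) s) := fun s => by
    by_cases hs : s ∈ Ioo 0 t
    · rw [indicator_of_mem hs, ← mul_assoc, ← Real.exp_add, slabStep, Finset.mul_sum,
        Finset.mul_sum]
      refine Finset.sum_congr rfl fun n _ => ?_
      by_cases hn : s ∈ timeSlab T N n
      · rw [indicator_of_mem hn, indicator_of_mem hn, propagator, indicator_of_mem hs,
          show -rate μ i * t + rate μ i * s = -rate μ i * (t - s) by ring]
        ring
      · simp [indicator_of_notMem hn]
    · rw [indicator_of_notMem hs]
      refine (Finset.sum_eq_zero fun n _ => ?_).symm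
      classical
      rw [indicator_apply, propagator, indicator_of_notMem hs]
      simp
  simp_rw [h]
  rw [integral_finsetSum]
  · refine Finset.sum_congr rfl fun n _ => ?_
    rw [integral_const_mul, integral_const_mul, integral_indicator (measurableSet_timeSlab T N n),
      slabMean]
  · intro n _
    exact (((integrable_propagator μ i t).indicator
      (measurableSet_timeSlab T N n)).const_mul _).const_mul _

theorem intervalIntegrable_exp_mul_slabStep (i : ℕ) (ρ : ℕ → ℝ) (a b : ℝ) :
    IntervalIntegrable (fun s => Real.exp (rate μ i * s) * (1 / (T / N) * slabStep T N ρ s))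
      volume a b :=
  ((integrable_slabStep T N ρ).const_mul _).intervalIntegrable.continuousOn_mul
    (by fun_prop)

theorem continuousOn_canvasCoeff (i : ℕ) (ρ : ℕ → ℝ) :
    ContinuousOn (canvasCoeff T μ N i ρ) (Icc 0 T) := by
  have h : ContinuousOn (fun t => -lam i * (Real.exp (-rate μ i * t) *
      ∫ s in (0 : ℝ)..t, Real.exp (rate μ i * s) * (1 / (T / N) * slabStep T N ρ s)))
      (Icc 0 T) := by
    have := (intervalIntegral.continuous_primitive
      (intervalIntegrable_exp_mul_slabStep (T := T) (μ := μ) (N := N) i ρ) 0)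
    fun_prop
  exact h.congr fun t ht => canvasCoeff_eq_integral i ρ ht.1

theorem canvasCoeff_zero (i : ℕ) (ρ : ℕ → ℝ) : canvasCoeff T μ N i ρ 0 = 0 := by
  simp [canvasCoeff_eq_integral i ρ le_rfl]

/-- Inside a slab the forcing is locally constant, so the fundamental theorem of calculus applies to
the Duhamel integral. -/
theorem hasDerivAt_canvasCoeff (hT : 0 < T) (i : ℕ) (ρ : ℕ → ℝ) {n : ℕ}
    (hn : n ∈ Finset.Icc 1 N) {t : ℝ} (ht : t ∈ timeSlab T N n) :
    HasDerivAt (canvasCoeff T μ N i ρ)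
      (-rate μ i * canvasCoeff T μ N i ρ t - lam i * (1 / (T / N) * ρ n)) t := by
  have ht0 : 0 < t := (timeSlab_subset hT hn ht).1
  have hev : slabStep T N ρ =ᶠ[nhds t] fun _ => ρ n := by
    filter_upwards [isOpen_Ioo.mem_nhds ht] with s hs using slabStep_of_mem hT ρ hn hs
  have hcont : ContinuousAt (slabStep T N ρ) t := continuousAt_const.congr hev.symm
  have h1 := intervalIntegral.integral_hasDerivAt_right
    (intervalIntegrable_exp_mul_slabStep (T := T) (μ := μ) (N := N) i ρ 0 t)
    (((by fun_prop : Measurable fun s => Real.exp (rate μ i * s)).mul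
      ((measurable_slabStep T N ρ).const_mul _)).stronglyMeasurable.stronglyMeasurableAtFilter)
    (by fun_prop)
  have h2 : HasDerivAt (fun t => Real.exp (-rate μ i * t))
      (Real.exp (-rate μ i * t) * -rate μ i) t :=
    ((hasDerivAt_id t).const_mul _).exp.congr_deriv (by simp)
  have h3 := (h2.mul h1).const_mul (-lam i)
  refine (h3.congr_deriv ?_).congr_of_eventuallyEq ?_
  · rw [canvasCoeff_eq_integral i ρ ht0.le, slabStep_of_mem hT ρ hn ht]
    have : Real.exp (-rate μ i * t) * Real.exp (rate μ i * t) = 1 := by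
      rw [← Real.exp_add]; simp
    linear_combination (-lam i * (1 / (T / N) * ρ n)) * this
  · filter_upwards [lt_mem_nhds ht0] with s hs using canvasCoeff_eq_integral i ρ hs.le

/-! ### Spatial derivatives of the modes. -/

theorem contDiff_sineMode (k : ℕ) {n : WithTop ℕ∞} : ContDiff ℝ n (sineMode k) := by
  unfold sineMode; fun_prop

theorem iteratedDeriv_even_sineMode (k j : ℕ) :
    iteratedDeriv (2 * j) (sineMode k) = fun x => (-1) ^ j * lam k ^ (2 * j) * sineMode k x := by
  ext x
  unfold sineMode
  rw [iteratedDeriv_const_mul_field, iteratedDeriv_comp_const_mul Real.contDiff_sin,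
    Real.iteratedDeriv_even_sin]
  simp only [Pi.mul_apply, Pi.pow_apply, Pi.neg_apply, Pi.one_apply]
  ring

theorem sineMode_zero_right (k : ℕ) : sineMode k 0 = 0 := by simp [sineMode]

theorem sineMode_one_right (k : ℕ) : sineMode k 1 = 0 := by simp [sineMode, lam]

theorem hasDerivAt_cosMode (k : ℕ) (x : ℝ) : HasDerivAt (cosMode k) (-lam k * sineMode k x) x := by
  refine ((((hasDerivAt_id x).const_mul (lam k)).cos).const_mul √2).congr_deriv ?_
  simp [sineMode]; ring

theorem spatialDeriv_sum_sineMode (s : Finset ℕ) (c : ℕ → ℝ → ℝ) (j : ℕ) (t : ℝ) {x : ℝ}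
    (hx : x ∈ Icc (0 : ℝ) 1) :
    spatialDeriv j (fun t x => ∑ i ∈ s, c i t * sineMode i x) t x =
      ∑ i ∈ s, c i t * iteratedDeriv j (sineMode i) x := by
  have h : ∀ i ∈ s, ContDiff ℝ j (fun x => c i t * sineMode i x) := fun i _ =>
    contDiff_const.mul (contDiff_sineMode i)
  rw [spatialDeriv, iteratedDerivWithin_eq_iteratedDeriv uniqueDiffOn_unit
    (ContDiff.contDiffAt (ContDiff.sum h)) hx, iteratedDeriv_fun_sum fun i hi => (h i hi).contDiffAt]
  simp_rw [iteratedDeriv_const_mul_field]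

/-- The canvas problem is solved by a trigonometric polynomial. -/
theorem isCanvasSolution_sum (hT : 0 < T) (M : ℕ) (ρ : ℕ → ℕ → ℝ) :
    IsCanvasSolution T μ N
      (fun t x => ∑ n ∈ Finset.Icc 1 N, (timeSlab T N n).indicator
        (fun _ => 1 / (T / N) * ∑ i ∈ Finset.Icc 1 M, ρ n i * cosMode i x) t)
      (fun t x => ∑ i ∈ Finset.Icc 1 M,
        canvasCoeff T μ N i (fun n => ρ n i) t * sineMode i x) := by
  have hmain : ∀ (j : ℕ) (A : Set ℝ), A ⊆ Icc 0 T → ContinuousOn (fun p : ℝ × ℝ =>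
      ∑ i ∈ Finset.Icc 1 M, canvasCoeff T μ N i (fun n => ρ n i) p.1 *
        iteratedDeriv j (sineMode i) p.2) (A ×ˢ Icc 0 1) := fun j A hA => by
    refine continuousOn_finsetSum _ fun i _ => ContinuousOn.mul ?_ ?_
    · exact (continuousOn_canvasCoeff i _).comp continuousOn_fst fun p hp => hA hp.1
    · exact (((contDiff_sineMode i).continuous_iteratedDeriv j le_rfl).comp
        continuous_snd).continuousOn
  refine ⟨by simpa using hmain 0 _ Subset.rfl, fun t _ => ?_, fun j _ => ?_, fun t ht x hx => ?_,
    fun x hx => ?_, fun n hn t ht x hx => ?_⟩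
  · exact ContDiff.contDiffOn (ContDiff.sum fun i _ => contDiff_const.mul (contDiff_sineMode i))
  · exact (hmain j _ Ioc_subset_Icc_self).congr fun p hp =>
      spatialDeriv_sum_sineMode _ (fun i => canvasCoeff T μ N i (fun n => ρ n i)) j p.1 hp.2
  · have hx' : x ∈ Icc (0 : ℝ) 1 := by rcases hx with rfl | rfl <;> simp
    rw [spatialDeriv_sum_sineMode _ (fun i => canvasCoeff T μ N i (fun n => ρ n i)) 2 t hx']
    have h0 : ∀ i, sineMode i x = 0 := fun i => by
      rcases hx with rfl | rfl
      · exact sineMode_zero_right i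
      · exact sineMode_one_right i
    have h2 : ∀ i, iteratedDeriv 2 (sineMode i) x = 0 := fun i => by
      rw [show 2 = 2 * 1 by rfl, iteratedDeriv_even_sineMode]; simp [h0]
    simp [h0, h2]
  · simp [canvasCoeff_zero]
  · have hx' := Ioo_subset_Icc_self hx
    have hd : HasDerivAt (fun s => ∑ i ∈ Finset.Icc 1 M,
        canvasCoeff T μ N i (fun n => ρ n i) s * sineMode i x)
        (∑ i ∈ Finset.Icc 1 M, (-rate μ i * canvasCoeff T μ N i (fun n => ρ n i) t -
          lam i * (1 / (T / N) * ρ n i)) * sineMode i x) t :=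
      HasDerivAt.fun_sum fun i _ => (hasDerivAt_canvasCoeff hT i _ hn ht).mul_const _
    refine ⟨hd.differentiableAt, ?_⟩
    -- At a time inside a slab only one term of the load survives, so its x-derivative is that of a
    -- cosine polynomial.
    have hg : (fun x => ∑ n ∈ Finset.Icc 1 N, (timeSlab T N n).indicator
        (fun _ => 1 / (T / N) * ∑ i ∈ Finset.Icc 1 M, ρ n i * cosMode i x) t) =
        fun x => 1 / (T / N) * ∑ i ∈ Finset.Icc 1 M, ρ n i * cosMode i x := by
      ext x
      exact slabStep_of_mem hT _ hn ht
    have hgd : HasDerivAt (fun x => 1 / (T / N) * ∑ i ∈ Finset.Icc 1 M, ρ n i * cosMode i x)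
        (1 / (T / N) * ∑ i ∈ Finset.Icc 1 M, ρ n i * (-lam i * sineMode i x)) x :=
      (HasDerivAt.fun_sum fun i _ => (hasDerivAt_cosMode i x).const_mul _).const_mul _
    rw [hd.deriv, hg, hgd.deriv,
      spatialDeriv_sum_sineMode _ (fun i => canvasCoeff T μ N i (fun n => ρ n i)) 4 t hx',
      spatialDeriv_sum_sineMode _ (fun i => canvasCoeff T μ N i (fun n => ρ n i)) 2 t hx',
      Finset.mul_sum, Finset.mul_sum, ← Finset.sum_add_distrib, ← Finset.sum_add_distrib]
    refine Finset.sum_congr rfl fun i _ => ?_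
    rw [show 2 = 2 * 1 by rfl, show 4 = 2 * 2 by rfl, iteratedDeriv_even_sineMode,
      iteratedDeriv_even_sineMode, rate]
    ring

end Explicit

/-! ### Projection of the propagators onto the piecewise constant functions -/

section Modes

/-- The error of the `k`-th propagator after projection onto the functions which are constant on
each time slab, modes `k > M` being discarded. -/
def modeError (T μ : ℝ) (N M k : ℕ) (t s : ℝ) : ℝ :=
  propagator μ k t s -
    if k ≤ M then slabStep T N (slabMean T N (propagator μ k t)) s else 0

/-- The squared `L²(0,T)` norm of `modeError`. -/
def modeVariance (T μ : ℝ) (N M k : ℕ) (t : ℝ) : ℝ :=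
  ∫ s in Icc 0 T, modeError T μ N M k t s ^ 2

/-- A bound for all the propagators on `[0,T]`. -/
def propagatorBound (T μ : ℝ) : ℝ := Real.exp (μ ^ 2 / 4 * T)

variable {T μ : ℝ} {N : ℕ}

theorem propagatorBound_pos (T μ : ℝ) : 0 < propagatorBound T μ := Real.exp_pos _

/-- The quadratic z(z - μ) has minimum -μ²/4. This bounds all propagators on [0,T] uniformly in k,
including the modes that grow. -/
theorem neg_sq_div_four_le_rate (μ : ℝ) (k : ℕ) : -(μ ^ 2 / 4) ≤ rate μ k := by
  rw [rate]; nlinarith [sq_nonneg (lam k ^ 2 - μ / 2)]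

theorem exp_rate_le (μ : ℝ) (k : ℕ) {τ : ℝ} (h0 : 0 ≤ τ) (hT : τ ≤ T) :
    Real.exp (-rate μ k * τ) ≤ propagatorBound T μ := by
  refine Real.exp_le_exp.2 ?_
  have h := neg_sq_div_four_le_rate μ k
  nlinarith [sq_nonneg μ, mul_nonneg (sq_nonneg μ) (sub_nonneg.2 hT)]

theorem propagator_nonneg (μ : ℝ) (k : ℕ) (t s : ℝ) : 0 ≤ propagator μ k t s :=
  indicator_nonneg (fun _ _ => (Real.exp_pos _).le) _

theorem propagator_le (μ : ℝ) (k : ℕ) {t : ℝ} (ht : t ≤ T) (s : ℝ) :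
    propagator μ k t s ≤ propagatorBound T μ := by
  refine indicator_apply_le' (fun hs => exp_rate_le μ k (sub_nonneg.2 hs.2.le) ?_)
    fun _ => (propagatorBound_pos T μ).le
  linarith [hs.1]

theorem norm_propagator_le (μ : ℝ) (k : ℕ) {t : ℝ} (ht : t ≤ T) (s : ℝ) :
    ‖propagator μ k t s‖ ≤ propagatorBound T μ := by
  rw [Real.norm_of_nonneg (propagator_nonneg μ k t s)]
  exact propagator_le μ k ht s

theorem integrableOn_sq_of_bounded {f : ℝ → ℝ} (hf : Measurable f) {K : ℝ} (hK : ∀ s, ‖f s‖ ≤ K)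
    {A : Set ℝ} (hA : volume A ≠ ∞) : IntegrableOn (fun s => f s ^ 2) A := by
  refine Measure.integrableOn_of_bounded (M := K ^ 2) hA (hf.pow_const 2).aestronglyMeasurable
    (.of_forall fun s => ?_)
  rw [norm_pow]
  gcongr
  exact hK s

theorem volume_timeSlab (T : ℝ) (N n : ℕ) : volume (timeSlab T N n) = ENNReal.ofReal (T / N) := by
  rw [timeSlab, Real.volume_Ioo]; congr 1; ring

theorem measureReal_timeSlab (hT : 0 < T) (N n : ℕ) : volume.real (timeSlab T N n) = T / N := by
  rw [measureReal_def, volume_timeSlab, ENNReal.toReal_ofReal (by positivity)]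

theorem volume_timeSlab_ne_top (T : ℝ) (N n : ℕ) : volume (timeSlab T N n) ≠ ∞ := by
  simp [volume_timeSlab]

/-- The mean over a slab is the best constant approximation in the mean square sense. -/
theorem integral_sub_slabMean_sq_le (hT : 0 < T) (hN : 1 ≤ N) {f : ℝ → ℝ} (hf : Measurable f)
    {K : ℝ} (hK : ∀ s, ‖f s‖ ≤ K) (n : ℕ) (c : ℝ) :
    ∫ s in timeSlab T N n, (f s - slabMean T N f n) ^ 2 ≤ ∫ s in timeSlab T N n, (f s - c) ^ 2 := by
  have hΔ : 0 < T / N := div_pos hT (by exact_mod_cast hN)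
  have hvol := volume_timeSlab_ne_top T N n
  have hfi : IntegrableOn f (timeSlab T N n) :=
    Measure.integrableOn_of_bounded hvol hf.aestronglyMeasurable (.of_forall hK)
  have hsq := integrableOn_sq_of_bounded hf hK hvol
  -- As a quadratic polynomial in b, the integral has its vertex at the mean; two values differ by
  -- Δt times a square.
  have hexp : ∀ b : ℝ, ∫ s in timeSlab T N n, (f s - b) ^ 2 =
      (∫ s in timeSlab T N n, f s ^ 2) - 2 * b * (T / N * slabMean T N f n) + T / N * b ^ 2 := by
    intro b
    have e : ∀ s, (f s - b) ^ 2 = f s ^ 2 - 2 * b * f s + b ^ 2 := fun s => by ring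
    have hconst : IntegrableOn (fun _ : ℝ => b ^ 2) (timeSlab T N n) := integrableOn_const hvol
    have hdiff : IntegrableOn (fun s => f s ^ 2 - 2 * b * f s) (timeSlab T N n) :=
      hsq.sub (hfi.const_mul _)
    simp_rw [e]
    rw [integral_add hdiff hconst, integral_sub hsq (hfi.const_mul _),
      integral_const_mul, setIntegral_const, measureReal_timeSlab hT, slabMean, smul_eq_mul]
    field_simp
  rw [hexp, hexp]
  nlinarith [mul_nonneg hΔ.le (sq_nonneg (slabMean T N f n - c))]

/-- The open slabs fill [0,T] up to finitely many nodes. Summation from 0 puts slab n + 1 between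
nodes n and n + 1, as telescoping needs. -/
theorem integral_eq_sum_timeSlab (hT : 0 < T) (hN : 1 ≤ N) {g : ℝ → ℝ}
    (hg : IntegrableOn g (Icc 0 T)) :
    ∫ s in Icc 0 T, g s = ∑ n ∈ Finset.range N, ∫ s in timeSlab T N (n + 1), g s := by
  have hN' : (0 : ℝ) < N := by exact_mod_cast hN
  have hΔ : 0 < T / N := div_pos hT hN'
  have hmono : ∀ n : ℕ, (n : ℝ) * (T / N) ≤ (n + 1 : ℕ) * (T / N) := fun n => by
    push_cast; nlinarith
  have hend : (N : ℝ) * (T / N) = T := mul_div_cancel₀ _ hN'.ne'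
  have h := intervalIntegral.sum_integral_adjacent_intervals (f := g) (μ := volume)
    (a := fun n : ℕ => (n : ℝ) * (T / N)) (n := N) fun n hn => by
      rw [intervalIntegrable_iff_integrableOn_Icc_of_le (hmono n)]
      refine hg.mono_set (Icc_subset_Icc (by positivity) ?_)
      have : ((n + 1 : ℕ) : ℝ) ≤ N := by exact_mod_cast hn
      calc _ ≤ (N : ℝ) * (T / N) := by gcongr
        _ = T := hend
  simp only [hend, Nat.cast_zero, zero_mul] at h
  rw [integral_Icc_eq_integral_Ioc, ← intervalIntegral.integral_of_le hT.le, ← h]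
  refine Finset.sum_congr rfl fun n _ => ?_
  rw [intervalIntegral.integral_of_le (hmono n), integral_Ioc_eq_integral_Ioo]
  simp [timeSlab]

theorem norm_slabMean_le (hT : 0 < T) (hN : 1 ≤ N) {f : ℝ → ℝ} {K : ℝ} (hK : ∀ s, ‖f s‖ ≤ K)
    (n : ℕ) : ‖slabMean T N f n‖ ≤ K := by
  have hΔ : 0 < T / N := div_pos hT (by exact_mod_cast hN)
  have h := norm_setIntegral_le_of_norm_le_const (f := f)
    (volume_timeSlab_ne_top T N n).lt_top fun s _ => hK s
  rw [measureReal_timeSlab hT] at h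
  rw [slabMean, norm_mul, Real.norm_of_nonneg (by positivity), one_div,
    inv_mul_le_iff₀ hΔ, mul_comm]
  exact h

theorem norm_slabStep_le (hT : 0 < T) {ρ : ℕ → ℝ} {K : ℝ} (hK0 : 0 ≤ K) (hK : ∀ n, ‖ρ n‖ ≤ K)
    (s : ℝ) : ‖slabStep T N ρ s‖ ≤ K := by
  by_cases h : ∃ n ∈ Finset.Icc 1 N, s ∈ timeSlab T N n
  · obtain ⟨n, hn, hs⟩ := h
    rw [slabStep_of_mem hT ρ hn hs]
    exact hK n
  · push Not at h
    rw [slabStep, Finset.sum_eq_zero fun n hn => indicator_of_notMem (h n hn) _]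
    simpa using hK0

/-! ### Size of the projection error of a single mode. -/

theorem measurable_modeError (T μ : ℝ) (N M k : ℕ) (t : ℝ) :
    Measurable (modeError T μ N M k t) := by
  unfold modeError
  split_ifs
  · exact (measurable_propagator μ k t).sub (measurable_slabStep T N _)
  · exact (measurable_propagator μ k t).sub measurable_const

theorem norm_modeError_le (hT : 0 < T) (hN : 1 ≤ N) (M k : ℕ) {t : ℝ} (ht : t ≤ T) (s : ℝ) :
    ‖modeError T μ N M k t s‖ ≤ 2 * propagatorBound T μ := by
  have hH := propagatorBound_pos T μ
  rw [modeError, two_mul]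
  refine (norm_sub_le _ _).trans (add_le_add (norm_propagator_le μ k ht s) ?_)
  split_ifs
  · exact norm_slabStep_le hT hH.le (norm_slabMean_le hT hN (norm_propagator_le μ k ht)) s
  · simpa using hH.le

theorem integrableOn_modeError_sq (hT : 0 < T) (hN : 1 ≤ N) (M k : ℕ) {t : ℝ} (ht : t ≤ T) :
    IntegrableOn (fun s => modeError T μ N M k t s ^ 2) (Icc 0 T) :=
  integrableOn_sq_of_bounded (measurable_modeError T μ N M k t)
    (norm_modeError_le hT hN M k ht) (by simp)

theorem modeVariance_nonneg (T μ : ℝ) (N M k : ℕ) (t : ℝ) : 0 ≤ modeVariance T μ N M k t :=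
  integral_nonneg fun _ => sq_nonneg _

theorem modeVariance_eq_sum (hT : 0 < T) (hN : 1 ≤ N) {M k : ℕ} (hk : k ≤ M) {t : ℝ} (ht : t ≤ T) :
    modeVariance T μ N M k t = ∑ n ∈ Finset.range N, ∫ s in timeSlab T N (n + 1),
      (propagator μ k t s - slabMean T N (propagator μ k t) (n + 1)) ^ 2 := by
  rw [modeVariance, integral_eq_sum_timeSlab hT hN (integrableOn_modeError_sq hT hN M k ht)]
  refine Finset.sum_congr rfl fun n hn => setIntegral_congr_fun (measurableSet_timeSlab T N _)
    fun s hs => ?_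
  have hn' : n + 1 ∈ Finset.Icc 1 N := by simp at hn ⊢; omega
  simp only [modeError, if_pos hk, slabStep_of_mem hT _ hn' hs]

/-- Slab means are at least as good as the constant 0; for discarded modes there is equality. -/
theorem modeVariance_le_integral (hT : 0 < T) (hN : 1 ≤ N) (M k : ℕ) {t : ℝ} (ht : t ≤ T) :
    modeVariance T μ N M k t ≤ ∫ s in Icc 0 T, propagator μ k t s ^ 2 := by
  by_cases hk : k ≤ M
  · rw [modeVariance_eq_sum hT hN hk ht, integral_eq_sum_timeSlab hT hN
      (integrableOn_sq_of_bounded (measurable_propagator μ k t) (norm_propagator_le μ k ht)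
        (by simp))]
    refine Finset.sum_le_sum fun n _ => ?_
    simpa using integral_sub_slabMean_sq_le hT hN (measurable_propagator μ k t)
      (norm_propagator_le μ k ht) (n + 1) 0
  · simp [modeVariance, modeError, hk]

theorem sum_abs_sub_le {F : ℕ → ℝ} (hF : Monotone F ∨ Antitone F) {H : ℝ}
    (h0 : ∀ n, 0 ≤ F n) (hH : ∀ n, F n ≤ H) (N : ℕ) :
    ∑ n ∈ Finset.range N, |F (n + 1) - F n| ≤ H := by
  rcases hF with hF | hF
  · rw [Finset.sum_congr rfl fun n _ => abs_of_nonneg (sub_nonneg.2 (hF n.le_succ)),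
      Finset.sum_range_sub]
    linarith [h0 0, hH N]
  · rw [Finset.sum_congr rfl fun n _ => (abs_of_nonpos (sub_nonpos.2 (hF n.le_succ))).trans
      (neg_sub _ _), Finset.sum_range_sub']
    linarith [h0 N, hH 0]

/-- The projection error of a propagator, a function of bounded variation, is of first order in
the mean square sense. -/
theorem modeVariance_le_step (hT : 0 < T) (hN : 1 ≤ N) {M k : ℕ} (hk : k ≤ M) {t : ℝ}
    (ht : t ∈ Icc 0 T) :
    modeVariance T μ N M k t ≤ 2 * propagatorBound T μ ^ 2 * (T / N) := by
  have hN' : (0 : ℝ) < N := by exact_mod_cast hN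
  have hΔ : 0 < T / N := div_pos hT hN'
  set H := propagatorBound T μ with hH
  have hHpos : 0 < H := propagatorBound_pos T μ
  -- Samples of the exponential at the nodes, frozen at time t. They lie in [0,H] and are monotone,
  -- so their total variation is at most H whatever the rate.
  let F : ℕ → ℝ := fun n => Real.exp (-rate μ k * (t - min (n * (T / N)) t))
  -- The increment of J is 1 exactly on the slab with nΔt < t ≤ (n+1)Δt, so it accounts for the jump
  -- of the propagator at t.
  let J : ℕ → ℝ := fun n => if t ≤ n * (T / N) then 1 else 0
  have hF0 : ∀ n, 0 ≤ F n := fun n => (Real.exp_pos _).le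
  have hFH : ∀ n, F n ≤ H := fun n => exp_rate_le μ k (sub_nonneg.2 (min_le_right _ _)) (by
    have : 0 ≤ min ((n : ℝ) * (T / N)) t := le_min (by positivity) ht.1
    linarith [ht.2])
  have hmin : Monotone fun n : ℕ => min ((n : ℝ) * (T / N)) t := fun m n hmn => by
    dsimp only
    gcongr
  have hFmono : Monotone F ∨ Antitone F := by
    rcases le_total 0 (rate μ k) with h | h
    · refine .inl fun m n hmn => Real.exp_le_exp.2 ?_
      have := hmin hmn
      simp only at this
      nlinarith
    · refine .inr fun m n hmn => Real.exp_le_exp.2 ?_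
      have := hmin hmn
      simp only at this
      nlinarith
  -- The mean is compared with a convenient constant: 0 on slabs after t, where the propagator
  -- vanishes; 0 on the slab of the jump, at cost H²; the right node value before t. There the
  -- deviation is at most the node increment, and one of its two factors is replaced by H so that
  -- increments, not their squares, are summed.
  have key : ∀ n ∈ Finset.range N, ∫ s in timeSlab T N (n + 1),
      (propagator μ k t s - slabMean T N (propagator μ k t) (n + 1)) ^ 2 ≤
      T / N * (H * |F (n + 1) - F n| + H ^ 2 * (J (n + 1) - J n)) := by
    intro n hn
    have hstep : (n : ℝ) * (T / N) ≤ (n + 1 : ℕ) * (T / N) := by push_cast; nlinarith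
    have hn' : n + 1 ∈ Finset.Icc 1 N := by simp at hn ⊢; omega
    have hmem : ∀ s ∈ timeSlab T N (n + 1), n * (T / N) < s ∧ s < (n + 1 : ℕ) * (T / N) ∧ 0 < s :=
      fun s hs => by
        have h0 := (timeSlab_subset hT hn' hs).1
        simpa [timeSlab, h0] using hs
    have hbest := integral_sub_slabMean_sq_le hT hN (measurable_propagator μ k t)
      (norm_propagator_le μ k ht.2) (n + 1)
    have hbound : ∀ (c B : ℝ), (∀ s ∈ timeSlab T N (n + 1), (propagator μ k t s - c) ^ 2 ≤ B) →
        ∫ s in timeSlab T N (n + 1), (propagator μ k t s - c) ^ 2 ≤ T / N * B := fun c B hB => by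
      have h := norm_setIntegral_le_of_norm_le_const (volume_timeSlab_ne_top T N (n + 1)).lt_top
        (f := fun s => (propagator μ k t s - c) ^ 2) (C := B) fun s hs => by
          rw [Real.norm_of_nonneg (sq_nonneg _)]; exact hB s hs
      rw [measureReal_timeSlab hT, mul_comm] at h
      exact (le_abs_self _).trans h
    rcases le_or_gt t (n * (T / N)) with h1 | h1
    · refine (hbest 0).trans (hbound 0 _ fun s hs => ?_)
      have hJ : J (n + 1) - J n = 0 := by simp only [J, if_pos h1, if_pos (h1.trans hstep), sub_self]
      have hs' : s ∉ Ioo 0 t := fun h => by linarith [(hmem s hs).1, h.2]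
      rw [propagator, indicator_of_notMem hs', hJ]
      simpa using mul_nonneg hHpos.le (abs_nonneg _)
    rcases le_or_gt t ((n + 1 : ℕ) * (T / N)) with h2 | h2
    · refine (hbest 0).trans (hbound 0 _ fun s _ => ?_)
      have hJ : J (n + 1) - J n = 1 := by simp only [J, if_neg h1.not_ge, if_pos h2, sub_zero]
      rw [hJ, sub_zero, mul_one]
      have := pow_le_pow_left₀ (propagator_nonneg μ k t s) (propagator_le μ k ht.2 s) 2
      nlinarith [mul_nonneg hHpos.le (abs_nonneg (F (n + 1) - F n))]
    · refine (hbest (F (n + 1))).trans (hbound _ _ fun s hs => ?_)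
      have hJ : J (n + 1) - J n = 0 := by simp only [J, if_neg h1.not_ge, if_neg h2.not_ge, sub_self]
      obtain ⟨hs1, hs2, hs0⟩ := hmem s hs
      rw [hJ, mul_zero, add_zero, propagator, indicator_of_mem (show s ∈ Ioo 0 t from ⟨hs0, hs2.trans h2⟩)]
      have e1 : F (n + 1) = Real.exp (-rate μ k * (t - (n + 1 : ℕ) * (T / N))) := by
        simp only [F, min_eq_left h2.le]
      have e0 : F n = Real.exp (-rate μ k * (t - n * (T / N))) := by
        simp only [F, min_eq_left h1.le]
      have hd : |Real.exp (-rate μ k * (t - s)) - F (n + 1)| ≤ |F (n + 1) - F n| := by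
        rw [abs_sub_comm]
        rcases le_total 0 (rate μ k) with h | h
        · have i1 : F n ≤ Real.exp (-rate μ k * (t - s)) := by
            rw [e0]; exact Real.exp_le_exp.2 (by nlinarith)
          have i2 : Real.exp (-rate μ k * (t - s)) ≤ F (n + 1) := by
            rw [e1]; exact Real.exp_le_exp.2 (by nlinarith)
          rw [abs_of_nonneg (by linarith), abs_of_nonneg (by linarith)]
          linarith
        · have i1 : Real.exp (-rate μ k * (t - s)) ≤ F n := by
            rw [e0]; exact Real.exp_le_exp.2 (by nlinarith)
          have i2 : F (n + 1) ≤ Real.exp (-rate μ k * (t - s)) := by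
            rw [e1]; exact Real.exp_le_exp.2 (by nlinarith)
          rw [abs_of_nonpos (by linarith), abs_of_nonpos (by linarith)]
          linarith
      have hd2 : |F (n + 1) - F n| ≤ H :=
        abs_sub_le_iff.2 ⟨by linarith [hFH (n + 1), hF0 n], by linarith [hFH n, hF0 (n + 1)]⟩
      rw [← sq_abs, sq]
      exact mul_le_mul (hd.trans hd2) hd (abs_nonneg _) hHpos.le
  rw [modeVariance_eq_sum hT hN hk ht.2]
  refine (Finset.sum_le_sum key).trans ?_
  -- The variation contributes H · H and the jump H² · 1, whence the factor 2H².
  rw [← Finset.mul_sum, Finset.sum_add_distrib, ← Finset.mul_sum, ← Finset.mul_sum,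
    Finset.sum_range_sub]
  have h1 := sum_abs_sub_le hFmono hF0 hFH N
  have h2 : J N - J 0 ≤ 1 := by simp only [J]; split_ifs <;> norm_num
  have h3 : H * ∑ n ∈ Finset.range N, |F (n + 1) - F n| ≤ H * H := by gcongr
  have h4 : H ^ 2 * (J N - J 0) ≤ H ^ 2 * 1 := by gcongr
  nlinarith

/-! ### Growth of the rates and decay of the propagator norms. -/

theorem lam_pos {k : ℕ} (hk : 1 ≤ k) : 0 < lam k :=
  mul_pos (by exact_mod_cast hk) Real.pi_pos

theorem exists_rate_ge {κ : ℕ} (hκ : 1 ≤ κ) (hκμ : μ < (κ : ℝ) ^ 2 * Real.pi ^ 2) :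
    ∃ δ : ℝ, 0 < δ ∧ ∀ k, κ ≤ k → δ * (k : ℝ) ^ 4 ≤ rate μ k := by
  have hκ' : (1 : ℝ) ≤ κ := by exact_mod_cast hκ
  have hπ := Real.pi_pos
  -- For k ≥ κ, λ_k² - μ is at least π²k² if μ ≤ 0, and at least (π² - μ/κ²)k² if μ ≥ 0; the latter
  -- coefficient is positive by the assumption on κ.
  refine ⟨Real.pi ^ 2 * min (Real.pi ^ 2) (Real.pi ^ 2 - μ / κ ^ 2), ?_, fun k hk => ?_⟩
  · refine mul_pos (by positivity) (lt_min (by positivity) ?_)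
    rw [sub_pos, div_lt_iff₀ (by positivity)]
    linarith
  · have hk' : (κ : ℝ) ≤ k := by exact_mod_cast hk
    have key : min (Real.pi ^ 2) (Real.pi ^ 2 - μ / κ ^ 2) * (k : ℝ) ^ 2 ≤ lam k ^ 2 - μ := by
      have hl : lam k ^ 2 = Real.pi ^ 2 * (k : ℝ) ^ 2 := by rw [lam]; ring
      rw [hl]
      rcases le_total μ 0 with h | h
      · calc _ ≤ Real.pi ^ 2 * (k : ℝ) ^ 2 := by gcongr; exact min_le_left _ _
          _ ≤ _ := by linarith
      · calc _ ≤ (Real.pi ^ 2 - μ / κ ^ 2) * (k : ℝ) ^ 2 := by gcongr; exact min_le_right _ _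
          _ = Real.pi ^ 2 * k ^ 2 - μ * (k ^ 2 / κ ^ 2) := by ring
          _ ≤ _ := by
            have : 1 ≤ (k : ℝ) ^ 2 / κ ^ 2 := by
              rw [one_le_div (by positivity)]; gcongr
            nlinarith
    calc _ = lam k ^ 2 * (min (Real.pi ^ 2) (Real.pi ^ 2 - μ / κ ^ 2) * (k : ℝ) ^ 2) := by
          rw [lam]; ring
      _ ≤ _ := by rw [rate]; gcongr

theorem integral_propagator_sq_le {k : ℕ} (hk : 0 < rate μ k) {t : ℝ}
    (ht : t ∈ Icc 0 T) : ∫ s in Icc 0 T, propagator μ k t s ^ 2 ≤ 1 / (2 * rate μ k) := by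
  have h1 : ∀ s, propagator μ k t s ^ 2 =
      (Ioo 0 t).indicator (fun s => Real.exp (-(2 * rate μ k) * (t - s))) s := fun s => by
    rw [propagator]
    by_cases hs : s ∈ Ioo 0 t
    · rw [indicator_of_mem hs, indicator_of_mem hs, ← Real.exp_nat_mul]
      congr 1; push_cast; ring
    · simp [indicator_of_notMem hs]
  simp_rw [h1]
  rw [setIntegral_indicator measurableSet_Ioo,
    inter_eq_right.2 (Ioo_subset_Icc_self.trans (Icc_subset_Icc_right ht.2)),
    ← integral_Ioc_eq_integral_Ioo, ← intervalIntegral.integral_of_le ht.1,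
    intervalIntegral.integral_eq_sub_of_hasDerivAt
      (f := fun s => 1 / (2 * rate μ k) * Real.exp (-(2 * rate μ k) * (t - s)))]
  · have := Real.exp_pos (-(2 * rate μ k) * (t - 0))
    have h2 : 0 < 1 / (2 * rate μ k) := by positivity
    simp only [sub_self, mul_zero, Real.exp_zero, mul_one]
    nlinarith
  · intro s _
    refine ((((hasDerivAt_id s).const_sub t).const_mul _).exp.const_mul _).congr_deriv ?_
    simp only [id]
    field_simp
  · exact (by fun_prop : Continuous fun s => Real.exp (-(2 * rate μ k) * (t - s))
      ).intervalIntegrable _ _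

theorem integral_propagator_sq_le_bound (hT : 0 < T) (k : ℕ) {t : ℝ} (ht : t ∈ Icc 0 T) :
    ∫ s in Icc 0 T, propagator μ k t s ^ 2 ≤ T * propagatorBound T μ ^ 2 := by
  have h := norm_setIntegral_le_of_norm_le_const (μ := volume) (s := Icc 0 T)
    (f := fun s => propagator μ k t s ^ 2) (C := propagatorBound T μ ^ 2) (by simp) fun s _ => by
      rw [norm_pow]; gcongr; exact norm_propagator_le μ k ht.2 s
  rw [mul_comm]
  simpa [hT.le] using (le_abs_self _).trans h

/-- From κ on, the integral is at most 1/(2 rate), of order k⁻⁴. The finitely many modes below κ,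
whose rates may be negative, get the crude bound T H² times (κ/k)⁴ ≥ 1. -/
theorem exists_integral_propagator_sq_le (hT : 0 < T) {κ : ℕ} (hκ : 1 ≤ κ)
    (hκμ : μ < (κ : ℝ) ^ 2 * Real.pi ^ 2) :
    ∃ C : ℝ, 0 < C ∧ ∀ k, 1 ≤ k → ∀ t ∈ Icc 0 T,
      ∫ s in Icc 0 T, propagator μ k t s ^ 2 ≤ C / (k : ℝ) ^ 4 := by
  obtain ⟨δ, hδ, h⟩ := exists_rate_ge hκ hκμ
  have hH := propagatorBound_pos T μ
  refine ⟨1 / (2 * δ) + T * propagatorBound T μ ^ 2 * κ ^ 4, by positivity, fun k hk t ht => ?_⟩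
  have hk' : (0 : ℝ) < k := by exact_mod_cast hk
  rcases le_or_gt κ k with hle | hlt
  · have hr := h k hle
    have hpos : 0 < δ * (k : ℝ) ^ 4 := by positivity
    calc _ ≤ 1 / (2 * rate μ k) := integral_propagator_sq_le (hpos.trans_le hr) ht
      _ ≤ 1 / (2 * (δ * (k : ℝ) ^ 4)) := by gcongr
      _ = 1 / (2 * δ) / (k : ℝ) ^ 4 := by field_simp
      _ ≤ _ := by gcongr; exact le_add_of_nonneg_right (by positivity)
  · calc _ ≤ T * propagatorBound T μ ^ 2 * 1 := by
          rw [mul_one]; exact integral_propagator_sq_le_bound hT k ht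
      _ ≤ T * propagatorBound T μ ^ 2 * (κ ^ 4 / k ^ 4) := by
          gcongr
          rw [one_le_div (by positivity)]
          gcongr
      _ = T * propagatorBound T μ ^ 2 * κ ^ 4 / k ^ 4 := by ring
      _ ≤ _ := by gcongr; exact le_add_of_nonneg_left (by positivity)

/-! ### Continuity in t of the mode variances. -/

theorem continuousAt_propagator (μ : ℝ) (k : ℕ) {t s : ℝ} (h : s ≠ t) :
    ContinuousAt (fun t => propagator μ k t s) t := by
  by_cases hs : s ∈ Ioo 0 t
  · refine ContinuousAt.congr (f := fun t => Real.exp (-rate μ k * (t - s))) (by fun_prop) ?_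
    filter_upwards [lt_mem_nhds hs.2] with r hr
    exact (indicator_of_mem (show s ∈ Ioo 0 r from ⟨hs.1, hr⟩) 
          (fun s => Real.exp (-rate μ k * (r - s)))).symm
  · refine (continuousAt_const (y := (0 : ℝ))).congr ?_
    -- If s < t then s ≤ 0, and the propagator vanishes for every time; if s > t it vanishes for
    -- times near t.
    rcases lt_or_gt_of_ne h with h' | h'
    · refine .of_forall fun r => ?_
      exact (indicator_of_notMem (fun hr : s ∈ Ioo 0 r => hs ⟨hr.1, h'⟩) 
          (fun s => Real.exp (-rate μ k * (r - s)))).symm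
    · filter_upwards [gt_mem_nhds h'] with r hr
      exact (indicator_of_notMem (fun hr' : s ∈ Ioo 0 r => absurd hr'.2 hr.not_gt) 
          (fun s => Real.exp (-rate μ k * (r - s)))).symm

theorem continuousOn_slabMean_propagator (T μ : ℝ) (N k n : ℕ) :
    ContinuousOn (fun t => slabMean T N (propagator μ k t) n) (Icc 0 T) := by
  intro t ht
  refine ContinuousWithinAt.mul continuousWithinAt_const ?_
  refine continuousWithinAt_of_dominated (bound := fun _ => propagatorBound T μ)
    (.of_forall fun r => (measurable_propagator μ k r).aestronglyMeasurable) ?_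
    (integrableOn_const (volume_timeSlab_ne_top T N n)) ?_
  · filter_upwards [self_mem_nhdsWithin] with r hr
    exact .of_forall (norm_propagator_le μ k hr.2)
  · filter_upwards [ae_restrict_of_ae (Measure.ae_ne volume t)] with s hs
    exact (continuousAt_propagator μ k hs).continuousWithinAt

/-- Dominated convergence: the integrand is uniformly bounded and continuous in t except at s = t, a
null set. -/
theorem continuousOn_modeVariance (hT : 0 < T) (hN : 1 ≤ N) (M k : ℕ) :
    ContinuousOn (modeVariance T μ N M k) (Icc 0 T) := by
  intro t ht
  refine continuousWithinAt_of_dominated (bound := fun _ => (2 * propagatorBound T μ) ^ 2)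
    (.of_forall fun r => ((measurable_modeError T μ N M k r).pow_const 2).aestronglyMeasurable) ?_
    (integrableOn_const (by simp)) ?_
  · filter_upwards [self_mem_nhdsWithin] with r hr
    refine .of_forall fun s => ?_
    rw [norm_pow]
    gcongr
    exact norm_modeError_le hT hN M k hr.2 s
  · filter_upwards [ae_restrict_of_ae (Measure.ae_ne volume t)] with s hs
    refine ContinuousWithinAt.pow (ContinuousWithinAt.sub
      (continuousAt_propagator μ k hs).continuousWithinAt ?_) 2
    split_ifs
    · have : ContinuousOn (fun t => slabStep T N (slabMean T N (propagator μ k t)) s)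
          (Icc 0 T) := by
        refine continuousOn_finsetSum _ fun n _ => ?_
        by_cases hn : s ∈ timeSlab T N n
        · simpa only [indicator_of_mem hn] using continuousOn_slabMean_propagator T μ N k n
        · simpa only [indicator_of_notMem hn] using continuousOn_const
      exact this t ht
    · exact continuousWithinAt_const

end Modes

/-! ### Parseval's identity for absolutely convergent cosine series -/

section Parseval

theorem integral_cos_int_mul_pi (m : ℤ) :
    ∫ y in Ioo (0 : ℝ) 1, Real.cos (m * Real.pi * y) = if m = 0 then 1 else 0 := by
  rw [← integral_Ioc_eq_integral_Ioo, ← intervalIntegral.integral_of_le zero_le_one]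
  split_ifs with h
  · simp [h]
  · have hm : (m : ℝ) * Real.pi ≠ 0 := mul_ne_zero (by exact_mod_cast h) Real.pi_ne_zero
    rw [intervalIntegral.integral_comp_mul_left (fun y => Real.cos y) hm]
    simp [Real.sin_int_mul_pi]

theorem integrableOn_unit_of_continuous {f : ℝ → ℝ} (hf : Continuous f) :
    IntegrableOn f (Ioo 0 1) :=
  integrableOn_unit hf.continuousOn

theorem continuous_cosMode (k : ℕ) : Continuous (cosMode k) := by unfold cosMode; fun_prop

/-- Product to sum: the frequencies are j - k and j + k + 2, and the second is never zero because
the modes are numbered from 1. -/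
theorem integral_cosMode_mul_cosMode (j k : ℕ) :
    ∫ y in Ioo (0 : ℝ) 1, cosMode (j + 1) y * cosMode (k + 1) y = if j = k then 1 else 0 := by
  have h : ∀ y, cosMode (j + 1) y * cosMode (k + 1) y =
      Real.cos (((j : ℤ) - k : ℤ) * Real.pi * y) +
        Real.cos (((j : ℤ) + k + 2 : ℤ) * Real.pi * y) := fun y => by
    have h2 : √2 * √2 = 2 := Real.mul_self_sqrt (by norm_num)
    have e1 : (((j : ℤ) - k : ℤ) : ℝ) * Real.pi * y = lam (j + 1) * y - lam (k + 1) * y := by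
      simp only [lam]; push_cast; ring
    have e2 : (((j : ℤ) + k + 2 : ℤ) : ℝ) * Real.pi * y = lam (j + 1) * y + lam (k + 1) * y := by
      simp only [lam]; push_cast; ring
    rw [e1, e2, Real.cos_sub, Real.cos_add, cosMode, cosMode]
    linear_combination Real.cos (lam (j + 1) * y) * Real.cos (lam (k + 1) * y) * h2
  simp_rw [h]
  rw [integral_add (integrableOn_unit_of_continuous (by fun_prop))
    (integrableOn_unit_of_continuous (by fun_prop)), integral_cos_int_mul_pi,
    integral_cos_int_mul_pi, if_neg (by omega : (j : ℤ) + k + 2 ≠ 0), add_zero]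
  congr 1
  rw [sub_eq_zero, Nat.cast_inj]

theorem integral_sineMode_sq (k : ℕ) : ∫ x in Ioo (0 : ℝ) 1, sineMode (k + 1) x ^ 2 = 1 := by
  have h : ∀ x, sineMode (k + 1) x ^ 2 =
      1 - Real.cos ((2 * (k + 1) : ℤ) * Real.pi * x) := fun x => by
    have e : ((2 * (k + 1) : ℤ) : ℝ) * Real.pi * x = 2 * (lam (k + 1) * x) := by
      simp only [lam]; push_cast; ring
    rw [e, Real.cos_two_mul, sineMode, mul_pow, Real.sq_sqrt (by norm_num), Real.sin_sq]
    ring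
  simp_rw [h]
  rw [integral_sub (by simp) (integrableOn_unit_of_continuous (by fun_prop)),
    integral_cos_int_mul_pi, if_neg (by omega)]
  simp

theorem abs_cosMode_le (k : ℕ) (y : ℝ) : |cosMode k y| ≤ 2 := by
  rw [cosMode, abs_mul, abs_of_nonneg (Real.sqrt_nonneg 2)]
  have h1 : √2 ≤ 2 := by rw [Real.sqrt_le_left (by norm_num)]; norm_num
  nlinarith [Real.abs_cos_le_one (lam k * y), abs_nonneg (Real.cos (lam k * y)),
    Real.sqrt_nonneg 2]

theorem abs_sineMode_le (k : ℕ) (y : ℝ) : |sineMode k y| ≤ 2 := by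
  rw [sineMode, abs_mul, abs_of_nonneg (Real.sqrt_nonneg 2)]
  have h1 : √2 ≤ 2 := by rw [Real.sqrt_le_left (by norm_num)]; norm_num
  nlinarith [Real.abs_sin_le_one (lam k * y), abs_nonneg (Real.sin (lam k * y)),
    Real.sqrt_nonneg 2]

variable {b : ℕ → ℝ}

theorem summable_mul_cosMode (hb : Summable b) (y : ℝ) :
    Summable fun k => b k * cosMode (k + 1) y := by
  refine Summable.of_norm_bounded (hb.abs.mul_right 2) fun k => ?_
  rw [norm_mul]
  exact mul_le_mul_of_nonneg_left (abs_cosMode_le _ _) (abs_nonneg _)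

theorem continuous_tsum_cosMode (hb : Summable b) :
    Continuous fun y => ∑' k, b k * cosMode (k + 1) y := by
  refine continuous_tsum (fun k => (continuous_cosMode _).const_mul _) (hb.abs.mul_right 2)
    fun k y => ?_
  rw [norm_mul]
  exact mul_le_mul_of_nonneg_left (abs_cosMode_le _ _) (abs_nonneg _)

/-- An absolutely convergent cosine series may be integrated term by term against a continuous
function. -/
theorem hasSum_integral_mul_cosMode (hb : Summable b) {g : ℝ → ℝ} (hg : Continuous g) :
    HasSum (fun k => b k * ∫ y in Ioo (0 : ℝ) 1, cosMode (k + 1) y * g y)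
      (∫ y in Ioo (0 : ℝ) 1, (∑' k, b k * cosMode (k + 1) y) * g y) := by
  obtain ⟨K, hK⟩ := isCompact_Icc.exists_bound_of_continuousOn
    (s := Icc (0 : ℝ) 1) hg.continuousOn
  have h := hasSum_integral_of_summable_integral_norm
    (μ := volume.restrict (Ioo (0 : ℝ) 1)) (F := fun k y => b k * cosMode (k + 1) y * g y)
    (fun k => integrableOn_unit_of_continuous
      (((continuous_cosMode _).const_mul _).mul hg)) ?_
  · simp_rw [tsum_mul_right, mul_assoc, integral_const_mul] at h
    exact h
  · refine Summable.of_norm_bounded (hb.abs.mul_right (2 * K)) fun k => ?_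
    refine (norm_setIntegral_le_of_norm_le_const (C := |b k| * (2 * K)) (by simp)
      fun y hy => ?_).trans (by simp)
    rw [norm_norm, norm_mul, norm_mul, mul_assoc]
    exact mul_le_mul_of_nonneg_left (mul_le_mul (abs_cosMode_le _ _)
      (hK y (Ioo_subset_Icc_self hy)) (norm_nonneg _) zero_le_two) (abs_nonneg _)

theorem integral_cosMode_mul_tsum (hb : Summable b) (j : ℕ) :
    ∫ y in Ioo (0 : ℝ) 1, cosMode (j + 1) y * ∑' k, b k * cosMode (k + 1) y = b j := by
  have h := (hasSum_integral_mul_cosMode hb (continuous_cosMode (j + 1))).tsum_eq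
  simp_rw [integral_cosMode_mul_cosMode] at h
  rw [tsum_eq_single j (by intro k hk; simp [hk])] at h
  simp_rw [mul_comm (cosMode (j + 1) _)]
  simpa using h.symm

/-- Only orthonormality is used, not completeness: the series is integrated term by term against
itself. -/
theorem hasSum_sq_cosMode (hb : Summable b) :
    HasSum (fun k => b k ^ 2)
      (∫ y in Ioo (0 : ℝ) 1, (∑' k, b k * cosMode (k + 1) y) ^ 2) := by
  have h := hasSum_integral_mul_cosMode hb (continuous_tsum_cosMode hb)
  simp_rw [integral_cosMode_mul_tsum hb, ← sq] at h
  exact h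

theorem lintegral_sq_cosMode (hb : Summable b) :
    ∫⁻ y in Ioo (0 : ℝ) 1, ENNReal.ofReal ((∑' k, b k * cosMode (k + 1) y) ^ 2) =
      ∑' k, ENNReal.ofReal (b k ^ 2) := by
  have h := hasSum_sq_cosMode hb
  have hi : IntegrableOn (fun y => (∑' k, b k * cosMode (k + 1) y) ^ 2) (Ioo 0 1) :=
    integrableOn_unit_of_continuous ((continuous_tsum_cosMode hb).pow 2)
  rw [← ofReal_integral_eq_lintegral_ofReal hi
    (.of_forall fun _ => sq_nonneg _), ← h.tsum_eq,
    ENNReal.ofReal_tsum_of_nonneg (fun _ => sq_nonneg _) h.summable]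

end Parseval

/-! ### The kernel of the error -/

section Kernel

variable {T μ : ℝ} {N : ℕ}

/-- For fixed s < t, exp(-z) ≤ 1/z and the k⁴ growth of the rates give a majorant of order k⁻³. It
is not uniform as s → t, but convergence for each fixed s suffices. -/
theorem summable_lam_mul_propagator {κ : ℕ} (hκ : 1 ≤ κ) (hκμ : μ < (κ : ℝ) ^ 2 * Real.pi ^ 2)
    (t s : ℝ) : Summable fun k => lam (k + 1) * propagator μ (k + 1) t s := by
  by_cases hs : s ∈ Ioo 0 t
  · obtain ⟨δ, hδ, h⟩ := exists_rate_ge hκ hκμ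
    have hτ : 0 < t - s := sub_pos.2 hs.2
    have hsum : Summable fun k : ℕ => Real.pi / (δ * (t - s)) * (1 / ((k + 1 : ℕ) : ℝ) ^ 3) :=
      ((summable_nat_add_iff 1).2 (Real.summable_one_div_nat_pow.2 (by norm_num : 1 < 3))).mul_left _
    refine Summable.of_norm_bounded_eventually_nat hsum ?_
    filter_upwards [Filter.eventually_ge_atTop κ] with k hk
    have hr := h (k + 1) (by omega)
    have hk0 : (0 : ℝ) < (k + 1 : ℕ) := by positivity
    have hpos : 0 < δ * ((k + 1 : ℕ) : ℝ) ^ 4 := by positivity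
    have hx : 0 < rate μ (k + 1) * (t - s) := mul_pos (hpos.trans_le hr) hτ
    have hexp : Real.exp (-rate μ (k + 1) * (t - s)) ≤ 1 / (rate μ (k + 1) * (t - s)) := by
      rw [neg_mul, Real.exp_neg, ← one_div]
      gcongr
      linarith [Real.add_one_le_exp (rate μ (k + 1) * (t - s))]
    rw [propagator, indicator_of_mem hs, norm_mul, Real.norm_of_nonneg (lam_pos (by omega)).le,
      Real.norm_of_nonneg (Real.exp_pos _).le]
    calc _ ≤ lam (k + 1) * (1 / (δ * ((k + 1 : ℕ) : ℝ) ^ 4 * (t - s))) := by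
          have := (lam_pos (show 1 ≤ k + 1 by omega)).le
          refine mul_le_mul_of_nonneg_left (hexp.trans ?_) this
          gcongr
      _ = _ := by rw [lam]; field_simp
  · simp [propagator, indicator_of_notMem hs]

theorem summable_ite_le (f : ℕ → ℝ) (M : ℕ) : Summable fun k => if k + 1 ≤ M then f k else 0 :=
  summable_of_ne_finset_zero (s := Finset.range M) fun k hk => if_neg (by simp at hk; omega)

/-- The coefficients in the cosine expansion of the error at the point `(t,x)`. -/
def errorCoeff (T μ : ℝ) (N M : ℕ) (t x s : ℝ) (k : ℕ) : ℝ :=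
  -lam (k + 1) * sineMode (k + 1) x * modeError T μ N M (k + 1) t s

/-- The function whose Wiener integral is the error at the point `(t,x)`. -/
def errorKernel (T μ : ℝ) (N M : ℕ) (t x : ℝ) (p : ℝ × ℝ) : ℝ :=
  ∑' k, errorCoeff T μ N M t x p.1 k * cosMode (k + 1) p.2

/-- The function whose Wiener integral is the solution of the canvas problem at `(t,x)`. -/
def canvasKernel (T μ : ℝ) (N M : ℕ) (t x : ℝ) : ℝ × ℝ → ℝ :=
  ∑ i ∈ Finset.Icc 1 M, (-lam i * sineMode i x) • ∑ n ∈ Finset.Icc 1 N,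
    slabMean T N (propagator μ i t) n •
      fun p : ℝ × ℝ => (timeSlab T N n).indicator (fun _ => cosMode i p.2) p.1

theorem summable_sineMode_mul {f : ℕ → ℝ} (hf : Summable f) (x : ℝ) :
    Summable fun k => f k * sineMode (k + 1) x := by
  refine Summable.of_norm_bounded (hf.abs.mul_right 2) fun k => ?_
  rw [norm_mul]
  exact mul_le_mul_of_nonneg_left (abs_sineMode_le _ _) (abs_nonneg _)

theorem summable_errorCoeff {κ : ℕ} (hκ : 1 ≤ κ) (hκμ : μ < (κ : ℝ) ^ 2 * Real.pi ^ 2)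
    (T : ℝ) (N M : ℕ) (t x s : ℝ) : Summable (errorCoeff T μ N M t x s) := by
  have h := ((summable_sineMode_mul (summable_lam_mul_propagator hκ hκμ t s) x).sub
    (summable_ite_le (fun k => lam (k + 1) * sineMode (k + 1) x *
      slabStep T N (slabMean T N (propagator μ (k + 1) t)) s) M)).neg
  refine h.congr fun k => ?_
  rw [errorCoeff, modeError]
  split_ifs <;> ring

theorem sum_Icc_eq_tsum (M : ℕ) (f : ℕ → ℝ) :
    ∑ i ∈ Finset.Icc 1 M, f i = ∑' k, if k + 1 ≤ M then f (k + 1) else 0 := by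
  rw [tsum_eq_sum (s := Finset.range M) fun k hk => if_neg (by simp at hk; omega),
    Finset.sum_congr rfl fun k hk => if_pos (by simp at hk; omega),
    Finset.range_eq_Ico, Finset.sum_Ico_add' (fun i => f i) 0 M 1]
  rfl

theorem canvasKernel_apply (T μ : ℝ) (N M : ℕ) (t x : ℝ) (p : ℝ × ℝ) :
    canvasKernel T μ N M t x p = ∑ i ∈ Finset.Icc 1 M, -lam i * sineMode i x *
      slabStep T N (slabMean T N (propagator μ i t)) p.1 * cosMode i p.2 := by
  rw [canvasKernel, Finset.sum_apply]
  refine Finset.sum_congr rfl fun i _ => ?_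
  rw [Pi.smul_apply, Finset.sum_apply, smul_eq_mul, slabStep, mul_assoc (-lam i * sineMode i x),
    Finset.sum_mul]
  congr 1
  refine Finset.sum_congr rfl fun n _ => ?_
  by_cases h : p.1 ∈ timeSlab T N n
  · simp [indicator_of_mem h]
  · simp [indicator_of_notMem h]

/-- Both kernels are cosine series in y, the canvas one with finitely many nonzero terms, so they
subtract term by term. -/
theorem mildKernel_sub_canvasKernel {κ : ℕ} (hκ : 1 ≤ κ)
    (hκμ : μ < (κ : ℝ) ^ 2 * Real.pi ^ 2) (T : ℝ) (N M : ℕ) (t x : ℝ) :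
    (fun p : ℝ × ℝ => (Ioo 0 t).indicator (fun s => mildKernel μ (t - s) x p.2) p.1) -
      canvasKernel T μ N M t x = errorKernel T μ N M t x := by
  ext p
  have h1 : (Ioo 0 t).indicator (fun s => mildKernel μ (t - s) x p.2) p.1 =
      ∑' k, -(lam (k + 1) * propagator μ (k + 1) t p.1 * sineMode (k + 1) x) *
        cosMode (k + 1) p.2 := by
    by_cases hs : p.1 ∈ Ioo 0 t
    · rw [indicator_of_mem hs, mildKernel, ← tsum_neg]
      refine tsum_congr fun k => ?_
      rw [propagator, indicator_of_mem hs, rate]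
      ring_nf
    · rw [indicator_of_notMem hs]
      simp [propagator, indicator_of_notMem hs]
  have s1 := summable_mul_cosMode
    (summable_sineMode_mul (summable_lam_mul_propagator hκ hκμ t p.1) x).neg p.2
  rw [Pi.sub_apply, h1, canvasKernel_apply, sum_Icc_eq_tsum, ← s1.tsum_sub (summable_ite_le _ M),
    errorKernel]
  refine tsum_congr fun k => ?_
  rw [errorCoeff, modeError]
  split_ifs <;> ring

theorem measurable_errorKernel {κ : ℕ} (hκ : 1 ≤ κ) (hκμ : μ < (κ : ℝ) ^ 2 * Real.pi ^ 2)
    (T : ℝ) (N M : ℕ) (t x : ℝ) : Measurable (errorKernel T μ N M t x) := by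
  refine measurable_of_tendsto_metrizable (f := fun n p => ∑ k ∈ Finset.range n,
    errorCoeff T μ N M t x p.1 k * cosMode (k + 1) p.2) (fun n => ?_) ?_
  · refine Finset.measurable_fun_sum _ fun k _ => Measurable.mul ?_ ?_
    · exact ((measurable_modeError T μ N M (k + 1) t).comp measurable_fst).const_mul _
    · exact (continuous_cosMode _).measurable.comp measurable_snd
  · refine tendsto_pi_nhds.2 fun p => ?_
    exact (summable_mul_cosMode (summable_errorCoeff hκ hκμ T N M t x p.1) p.2
      ).hasSum.tendsto_sum_nat

/-- Tonelli: Parseval in y for each fixed time s, then interchange of the series with the time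
integral. Extended nonnegative values make a separate integrability proof unnecessary. -/
theorem lintegral_errorKernel_sq (hT : 0 < T) (hN : 1 ≤ N) {κ : ℕ} (hκ : 1 ≤ κ)
    (hκμ : μ < (κ : ℝ) ^ 2 * Real.pi ^ 2) (M : ℕ) {t : ℝ} (ht : t ≤ T) (x : ℝ) :
    ∫⁻ p, ENNReal.ofReal (errorKernel T μ N M t x p ^ 2) ∂spaceTimeMeasure T =
      ∑' k, ENNReal.ofReal (sineMode (k + 1) x ^ 2) *
        ENNReal.ofReal (lam (k + 1) ^ 2 * modeVariance T μ N M (k + 1) t) := by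
  have hmeas := ((measurable_errorKernel hκ hκμ T N M t x).pow_const 2).ennreal_ofReal
  rw [spaceTimeMeasure, spaceTime, Measure.volume_eq_prod, ← Measure.prod_restrict,
    lintegral_prod _ hmeas.aemeasurable]
  have h1 : ∀ s, ∫⁻ y in Ioo (0 : ℝ) 1, ENNReal.ofReal (errorKernel T μ N M t x (s, y) ^ 2) =
      ∑' k, ENNReal.ofReal (errorCoeff T μ N M t x s k ^ 2) := fun s =>
    lintegral_sq_cosMode (summable_errorCoeff hκ hκμ T N M t x s)
  simp_rw [h1]
  have hcoeff : ∀ k, Measurable fun s => ENNReal.ofReal (errorCoeff T μ N M t x s k ^ 2) :=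
    fun k => (((measurable_modeError T μ N M (k + 1) t).const_mul _).pow_const 2).ennreal_ofReal
  rw [lintegral_tsum fun k => (hcoeff k).aemeasurable]
  refine tsum_congr fun k => ?_
  have h2 : ∀ s, ENNReal.ofReal (errorCoeff T μ N M t x s k ^ 2) =
      ENNReal.ofReal (sineMode (k + 1) x ^ 2 * lam (k + 1) ^ 2) *
        ENNReal.ofReal (modeError T μ N M (k + 1) t s ^ 2) := fun s => by
    rw [← ENNReal.ofReal_mul (by positivity), errorCoeff]
    congr 1; ring
  simp_rw [h2]
  rw [lintegral_const_mul _ ((measurable_modeError T μ N M (k + 1) t).pow_const 2).ennreal_ofReal,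
    ← ofReal_integral_eq_lintegral_ofReal (integrableOn_modeError_sq hT hN M (k + 1) ht)
      (.of_forall fun _ => sq_nonneg _), ← ENNReal.ofReal_mul (by positivity),
    ← ENNReal.ofReal_mul (by positivity), mul_assoc]
  rfl

theorem eLpNorm_two_sq {α : Type*} [MeasurableSpace α] (m : Measure α) (f : α → ℝ) :
    eLpNorm f 2 m ^ 2 = ∫⁻ a, ENNReal.ofReal (f a ^ 2) ∂m := by
  have h := eLpNorm_nnreal_pow_eq_lintegral (f := f) (μ := m) (p := 2) two_ne_zero
  simp only [NNReal.coe_ofNat, ENNReal.rpow_ofNat, ENNReal.coe_ofNat] at h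
  rw [h]
  refine lintegral_congr fun a => ?_
  rw [← ofReal_norm, ← ENNReal.ofReal_pow (norm_nonneg _), Real.norm_eq_abs, sq_abs]

end Kernel

/-! ### Estimate of the error series -/

section ErrorSeries

variable {T μ : ℝ} {N : ℕ}

/-- The squared mean square error, the sum of the weighted mode variances. -/
def errorSum (T μ : ℝ) (N M : ℕ) (t : ℝ) : ℝ :=
  ∑' k, lam (k + 1) ^ 2 * modeVariance T μ N M (k + 1) t

/-- The factor λ_k² turns k⁻⁴ into k⁻². This majorant, independent of N, M and t, serves the tail
estimates as well as the uniform convergence. -/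
theorem exists_errorTerm_le (hT : 0 < T) {κ : ℕ} (hκ : 1 ≤ κ)
    (hκμ : μ < (κ : ℝ) ^ 2 * Real.pi ^ 2) :
    ∃ C : ℝ, 0 < C ∧ ∀ N M : ℕ, 1 ≤ N → ∀ k, ∀ t ∈ Icc 0 T,
      lam (k + 1) ^ 2 * modeVariance T μ N M (k + 1) t ≤ C * (((k + 1 : ℕ) : ℝ) ^ 2)⁻¹ := by
  obtain ⟨C, hC, h⟩ := exists_integral_propagator_sq_le hT hκ hκμ
  refine ⟨Real.pi ^ 2 * C, by positivity, fun N M hN k t ht => ?_⟩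
  have hk : (0 : ℝ) < (k + 1 : ℕ) := by positivity
  calc _ ≤ lam (k + 1) ^ 2 * (C / ((k + 1 : ℕ) : ℝ) ^ 4) := by
        gcongr
        exact (modeVariance_le_integral hT hN M (k + 1) ht.2).trans (h (k + 1) (by omega) t ht)
    _ = _ := by rw [lam]; field_simp

theorem summable_inv_sq_succ : Summable fun k : ℕ => (((k + 1 : ℕ) : ℝ) ^ 2)⁻¹ :=
  (summable_nat_add_iff 1).2 (Real.summable_nat_pow_inv.2 one_lt_two)

theorem errorTerm_nonneg (T μ : ℝ) (N M k : ℕ) (t : ℝ) :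
    0 ≤ lam (k + 1) ^ 2 * modeVariance T μ N M (k + 1) t :=
  mul_nonneg (sq_nonneg _) (modeVariance_nonneg T μ N M _ t)

theorem errorSum_nonneg (T μ : ℝ) (N M : ℕ) (t : ℝ) : 0 ≤ errorSum T μ N M t :=
  tsum_nonneg fun k => errorTerm_nonneg T μ N M k t

theorem summable_errorTerm (hT : 0 < T) (hN : 1 ≤ N) {κ : ℕ} (hκ : 1 ≤ κ)
    (hκμ : μ < (κ : ℝ) ^ 2 * Real.pi ^ 2) (M : ℕ) {t : ℝ} (ht : t ∈ Icc 0 T) :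
    Summable fun k => lam (k + 1) ^ 2 * modeVariance T μ N M (k + 1) t := by
  obtain ⟨C, -, h⟩ := exists_errorTerm_le hT hκ hκμ
  exact Summable.of_nonneg_of_le (fun k => errorTerm_nonneg T μ N M k t)
    (fun k => h N M hN k t ht) (summable_inv_sq_succ.mul_left C)

theorem continuousOn_errorSum (hT : 0 < T) (hN : 1 ≤ N) {κ : ℕ} (hκ : 1 ≤ κ)
    (hκμ : μ < (κ : ℝ) ^ 2 * Real.pi ^ 2) (M : ℕ) :
    ContinuousOn (errorSum T μ N M) (Icc 0 T) := by
  obtain ⟨C, -, h⟩ := exists_errorTerm_le hT hκ hκμ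
  refine continuousOn_tsum (fun k => (continuousOn_modeVariance hT hN M (k + 1)).const_mul _)
    (summable_inv_sq_succ.mul_left C) fun k t ht => ?_
  rw [Real.norm_of_nonneg (errorTerm_nonneg T μ N M k t)]
  exact h N M hN k t ht

/-- The form 2/(K+1) stays valid for K = 0, which occurs when Δt > 1. -/
theorem sum_ite_inv_sq_le (K n : ℕ) :
    ∑ k ∈ Finset.range n, (if K < k + 1 then (((k + 1 : ℕ) : ℝ) ^ 2)⁻¹ else 0) ≤ 2 / (K + 1) := by
  have h := Finset.sum_range_succ' (fun i : ℕ => if K < i then ((i : ℝ) ^ 2)⁻¹ else 0) n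
  simp only [not_lt_zero, if_false, add_zero] at h
  have hfilter : (Finset.range (n + 1)).filter (fun i => K < i) = Finset.Ioo K (n + 1) := by
    ext i
    rw [Finset.mem_filter, Finset.mem_range, Finset.mem_Ioo, and_comm]
  rw [← h, ← Finset.sum_filter, hfilter]
  exact sum_Ioo_inv_sq_le K (n + 1)

theorem sum_ite_sq_le (K n : ℕ) :
    ∑ k ∈ Finset.range n, (if k + 1 ≤ K then ((k + 1 : ℕ) : ℝ) ^ 2 else 0) ≤ (K : ℝ) ^ 3 := by
  rw [← Finset.sum_filter]
  calc _ ≤ ∑ k ∈ Finset.range K, ((k + 1 : ℕ) : ℝ) ^ 2 :=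
        Finset.sum_le_sum_of_subset_of_nonneg (fun k hk => by simp at hk ⊢; omega)
          fun _ _ _ => sq_nonneg _
    _ ≤ ∑ _k ∈ Finset.range K, (K : ℝ) ^ 2 := by
        refine Finset.sum_le_sum fun k hk => ?_
        have : k + 1 ≤ K := by simp at hk; omega
        gcongr
    _ = (K : ℝ) ^ 3 := by simp; ring

theorem exists_errorSum_le (hT : 0 < T) {κ : ℕ} (hκ : 1 ≤ κ)
    (hκμ : μ < (κ : ℝ) ^ 2 * Real.pi ^ 2) :
    ∃ C : ℝ, 0 < C ∧ ∀ N M : ℕ, 1 ≤ N → 1 ≤ M → ∀ t ∈ Icc 0 T,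
      errorSum T μ N M t ≤ C * ((T / N) ^ (1 / 4 : ℝ) + (M : ℝ)⁻¹) := by
  obtain ⟨C, hC, h⟩ := exists_errorTerm_le hT hκ hκμ
  set B := Real.pi ^ 2 * (2 * propagatorBound T μ ^ 2) with hB
  have hB0 : 0 ≤ B := by positivity
  refine ⟨B + 2 * C, by positivity, fun N M hN hM t ht => ?_⟩
  have hΔ : 0 < T / N := div_pos hT (by exact_mod_cast hN)
  set r := (T / N) ^ (1 / 4 : ℝ) with hr
  have hr0 : 0 < r := Real.rpow_pos_of_pos hΔ _
  have hr4 : r ^ 4 = T / N := by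
    rw [hr, ← Real.rpow_natCast, ← Real.rpow_mul hΔ.le]; norm_num
  have hM0 : (0 : ℝ) < M := by exact_mod_cast hM
  -- With r = Δt^(1/4), this cutoff balances the low part K³Δt against the tail 1/K; both are of
  -- order r.
  set K := ⌊1 / r⌋₊
  have hK1 : (K : ℝ) ≤ 1 / r := Nat.floor_le (by positivity)
  have hK2 : 1 / r < K + 1 := Nat.lt_floor_add_one _
  -- The step bound serves k ≤ min(K, M), the decay bound all other modes. Modes beyond both K and M
  -- are counted twice, which is harmless.
  have hterm : ∀ k, lam (k + 1) ^ 2 * modeVariance T μ N M (k + 1) t ≤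
      B * r ^ 4 * (if k + 1 ≤ K then ((k + 1 : ℕ) : ℝ) ^ 2 else 0) +
        C * (if K < k + 1 then (((k + 1 : ℕ) : ℝ) ^ 2)⁻¹ else 0) +
        C * (if M < k + 1 then (((k + 1 : ℕ) : ℝ) ^ 2)⁻¹ else 0) := fun k => by
    have h1 := h N M hN k t ht
    have h0 : 0 ≤ C * (((k + 1 : ℕ) : ℝ) ^ 2)⁻¹ := by positivity
    have h3 : 0 ≤ B * r ^ 4 * ((k + 1 : ℕ) : ℝ) ^ 2 := by positivity
    by_cases hkM : k + 1 ≤ M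
    · have h2 : lam (k + 1) ^ 2 * modeVariance T μ N M (k + 1) t ≤
          B * r ^ 4 * ((k + 1 : ℕ) : ℝ) ^ 2 := by
        calc _ ≤ lam (k + 1) ^ 2 * (2 * propagatorBound T μ ^ 2 * (T / N)) := by
              gcongr
              exact modeVariance_le_step hT hN hkM ht
          _ = _ := by rw [hr4, hB, lam]; ring
      rw [if_neg (show ¬ M < k + 1 by omega)]
      by_cases hkK : k + 1 ≤ K
      · rw [if_pos hkK, if_neg (by omega)]; linarith
      · rw [if_neg hkK, if_pos (by omega)]; linarith
    · rw [if_pos (show M < k + 1 by omega)]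
      by_cases hkK : k + 1 ≤ K
      · rw [if_pos hkK, if_neg (by omega)]; linarith
      · rw [if_neg hkK, if_pos (by omega)]; linarith
  refine Real.tsum_le_of_sum_range_le (fun k => errorTerm_nonneg T μ N M k t) fun n => ?_
  refine (Finset.sum_le_sum fun k _ => hterm k).trans ?_
  rw [Finset.sum_add_distrib, Finset.sum_add_distrib, ← Finset.mul_sum, ← Finset.mul_sum,
    ← Finset.mul_sum]
  have e1 : B * r ^ 4 * ∑ k ∈ Finset.range n, (if k + 1 ≤ K then ((k + 1 : ℕ) : ℝ) ^ 2 else 0) ≤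
      B * r := by
    calc _ ≤ B * r ^ 4 * (1 / r) ^ 3 := by
          gcongr
          exact (sum_ite_sq_le K n).trans (by gcongr)
      _ = B * r := by field_simp
  have e2 : C * ∑ k ∈ Finset.range n, (if K < k + 1 then (((k + 1 : ℕ) : ℝ) ^ 2)⁻¹ else 0) ≤
      C * (2 * r) := by
    gcongr
    refine (sum_ite_inv_sq_le K n).trans ?_
    calc (2 : ℝ) / (K + 1) ≤ 2 / (1 / r) := by gcongr
      _ = 2 * r := by field_simp
  have e3 : C * ∑ k ∈ Finset.range n, (if M < k + 1 then (((k + 1 : ℕ) : ℝ) ^ 2)⁻¹ else 0) ≤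
      C * (2 * (M : ℝ)⁻¹) := by
    gcongr
    refine (sum_ite_inv_sq_le M n).trans ?_
    calc (2 : ℝ) / (M + 1) ≤ 2 / M := by gcongr; linarith
      _ = 2 * (M : ℝ)⁻¹ := by ring
  -- The surplus B/M lets the single constant B + 2C stand before both terms.
  have e4 : 0 ≤ B * (M : ℝ)⁻¹ := by positivity
  nlinarith

theorem exists_sqrt_errorSum_le (hT : 0 < T) {κ : ℕ} (hκ : 1 ≤ κ)
    (hκμ : μ < (κ : ℝ) ^ 2 * Real.pi ^ 2) :
    ∃ C : ℝ, 0 < C ∧ ∀ N M : ℕ, 1 ≤ N → 1 ≤ M → ∀ t ∈ Icc 0 T,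
      √(errorSum T μ N M t) ≤ C * ((T / N) ^ (1 / 8 : ℝ) + (M : ℝ) ^ (-(1 / 2) : ℝ)) := by
  obtain ⟨C, hC, h⟩ := exists_errorSum_le hT hκ hκμ
  refine ⟨√C, Real.sqrt_pos.2 hC, fun N M hN hM t ht => ?_⟩
  have hΔ : 0 < T / N := div_pos hT (by exact_mod_cast hN)
  have hM0 : (0 : ℝ) < M := by exact_mod_cast hM
  have h1 : ((T / N) ^ (1 / 8 : ℝ)) ^ 2 = (T / N) ^ (1 / 4 : ℝ) := by
    rw [← Real.rpow_natCast, ← Real.rpow_mul hΔ.le]; norm_num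
  have h2 : ((M : ℝ) ^ (-(1 / 2) : ℝ)) ^ 2 = (M : ℝ)⁻¹ := by
    rw [← Real.rpow_natCast, ← Real.rpow_mul hM0.le, ← Real.rpow_neg_one]; norm_num
  have h3 : 0 ≤ (T / N) ^ (1 / 8 : ℝ) := by positivity
  have h4 : 0 ≤ (M : ℝ) ^ (-(1 / 2) : ℝ) := by positivity
  refine Real.sqrt_le_iff.2 ⟨by positivity, (h N M hN hM t ht).trans ?_⟩
  rw [mul_pow, Real.sq_sqrt hC.le, ← h1, ← h2]
  gcongr
  -- This is a² + b² ≤ (a + b)² for nonnegative a and b.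
  nlinarith [mul_nonneg h3 h4]

end ErrorSeries

/-! ### Representation of the error -/

section Representation

variable {Ω : Type*} [MeasurableSpace Ω] {T μ : ℝ} {N : ℕ} {P : Measure Ω}
  {W : BorelPart T → Ω → ℝ}

theorem memLp_slab_cosMode (T : ℝ) (N n i : ℕ) :
    MemLp (fun p : ℝ × ℝ => (timeSlab T N n).indicator (fun _ => cosMode i p.2) p.1) 2
      (spaceTimeMeasure T) := by
  have hfin : IsFiniteMeasure (spaceTimeMeasure T) := by
    refine ⟨?_⟩
    have h := spaceTimeMeasure_ne_top (T := T)
      ⟨spaceTime T, measurableSet_Icc.prod measurableSet_Ioo, Subset.rfl⟩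
    rw [spaceTimeMeasure, Measure.restrict_apply_univ]
    rw [spaceTimeMeasure, Measure.restrict_apply_self] at h
    exact h.lt_top
  refine MemLp.of_bound ?_ 2 (.of_forall fun p => ?_)
  · have h : (fun p : ℝ × ℝ => (timeSlab T N n).indicator (fun _ => cosMode i p.2) p.1) =
        (Prod.fst ⁻¹' timeSlab T N n).indicator fun p : ℝ × ℝ => cosMode i p.2 := by
      ext p
      by_cases hp : p.1 ∈ timeSlab T N n
      · rw [indicator_of_mem hp, indicator_of_mem (show p ∈ Prod.fst ⁻¹' timeSlab T N n from hp)]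
      · rw [indicator_of_notMem hp, indicator_of_notMem (show p ∉ Prod.fst ⁻¹' timeSlab T N n from hp)]
    rw [h]
    exact (((continuous_cosMode i).measurable.comp measurable_snd).indicator
      (measurable_fst (measurableSet_timeSlab T N n))).aestronglyMeasurable
  · by_cases hp : p.1 ∈ timeSlab T N n
    · rw [indicator_of_mem hp]; exact abs_cosMode_le i p.2
    · rw [indicator_of_notMem hp]; simp

theorem IsWhiteNoise.isWienerIntegral_modeIncrement (hW : IsWhiteNoise T P W) (N n i : ℕ) :
    IsWienerIntegral P W
      (fun p : ℝ × ℝ => (timeSlab T N n).indicator (fun _ => cosMode i p.2) p.1)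
      (modeIncrement P W N n i) :=
  hW.isWienerIntegral (memLp_slab_cosMode T N n i)

/-- The solution of the canvas problem. -/
def canvasField (μ : ℝ) (P : Measure Ω) (W : BorelPart T → Ω → ℝ) (N M : ℕ) (ω : Ω) (t x : ℝ) :
    ℝ :=
  ∑ i ∈ Finset.Icc 1 M, canvasCoeff T μ N i (fun n => modeIncrement P W N n i ω) t * sineMode i x

theorem isCanvasSolution_canvasField (hT : 0 < T) (μ : ℝ) (P : Measure Ω)
    (W : BorelPart T → Ω → ℝ) (N M : ℕ) (ω : Ω) :
    IsCanvasSolution T μ N (canvasLoad P W N M ω) (canvasField μ P W N M ω) :=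
  isCanvasSolution_sum hT M fun n i => modeIncrement P W N n i ω

/-- At a fixed point the field is a finite linear combination of the increments with deterministic
weights, so linearity identifies its integrand. -/
theorem IsWhiteNoise.isWienerIntegral_canvasField (hW : IsWhiteNoise T P W) (μ : ℝ) (N M : ℕ)
    (t x : ℝ) :
    IsWienerIntegral P W (canvasKernel T μ N M t x) (fun ω => canvasField μ P W N M ω t x) := by
  have h := IsWienerIntegral.sum hW (Finset.Icc 1 M) fun i _ =>
    (IsWienerIntegral.sum hW (Finset.Icc 1 N) fun n _ =>
      (hW.isWienerIntegral_modeIncrement N n i).smul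
        (slabMean T N (propagator μ i t) n)).smul (-lam i * sineMode i x)
  have e : (fun ω => canvasField μ P W N M ω t x) =
      ∑ i ∈ Finset.Icc 1 M, (-lam i * sineMode i x) • ∑ n ∈ Finset.Icc 1 N,
        slabMean T N (propagator μ i t) n • modeIncrement P W N n i := by
    ext ω
    simp only [canvasField, canvasCoeff, Finset.sum_apply, Pi.smul_apply, smul_eq_mul]
    refine Finset.sum_congr rfl fun i _ => ?_
    rw [mul_right_comm]
    simp_rw [mul_comm (modeIncrement P W N _ i ω)]
  rw [e]
  exact h

theorem IsWhiteNoise.aestronglyMeasurable_canvasField [SFinite P] (hW : IsWhiteNoise T P W)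
    (μ : ℝ) (N M : ℕ) (t : ℝ) :
    AEStronglyMeasurable (fun q : Ω × ℝ => canvasField μ P W N M q.1 t q.2)
      (P.prod (volume.restrict (Ioo 0 1))) := by
  unfold canvasField canvasCoeff
  refine Finset.aestronglyMeasurable_fun_sum _ fun i _ => AEStronglyMeasurable.mul
    (AEStronglyMeasurable.const_mul (Finset.aestronglyMeasurable_fun_sum _ fun n _ =>
      AEStronglyMeasurable.mul_const ?_ _) _) ?_
  · exact (hW.isWienerIntegral_modeIncrement N n i).2.1.1.comp_fst
  · exact ((contDiff_sineMode (n := 0) i).continuous.measurable.comp measurable_snd).aestronglyMeasurable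

theorem lintegral_errorKernel_sq_ne_top (hT : 0 < T) (hN : 1 ≤ N) {κ : ℕ} (hκ : 1 ≤ κ)
    (hκμ : μ < (κ : ℝ) ^ 2 * Real.pi ^ 2) (M : ℕ) {t : ℝ} (ht : t ∈ Icc 0 T) (x : ℝ) :
    ∫⁻ p, ENNReal.ofReal (errorKernel T μ N M t x p ^ 2) ∂spaceTimeMeasure T ≠ ∞ := by
  rw [lintegral_errorKernel_sq hT hN hκ hκμ M ht.2]
  refine ne_top_of_le_ne_top (b := ∑' k, ENNReal.ofReal 4 *
    ENNReal.ofReal (lam (k + 1) ^ 2 * modeVariance T μ N M (k + 1) t)) ?_ ?_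
  · rw [ENNReal.tsum_mul_left, ← ENNReal.ofReal_tsum_of_nonneg
      (fun k => errorTerm_nonneg T μ N M k t) (summable_errorTerm hT hN hκ hκμ M ht)]
    exact ENNReal.mul_ne_top ENNReal.ofReal_ne_top ENNReal.ofReal_ne_top
  · refine ENNReal.tsum_le_tsum fun k => ?_
    gcongr
    rw [← sq_abs]
    nlinarith [abs_sineMode_le (k + 1) x, abs_nonneg (sineMode (k + 1) x)]

theorem memLp_mildKernel (hT : 0 < T) {κ : ℕ} (hκ : 1 ≤ κ)
    (hκμ : μ < (κ : ℝ) ^ 2 * Real.pi ^ 2) {t : ℝ} (ht : t ∈ Icc 0 T) (x : ℝ) :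
    MemLp (fun p : ℝ × ℝ => (Ioo 0 t).indicator (fun s => mildKernel μ (t - s) x p.2) p.1) 2
      (spaceTimeMeasure T) := by
  -- With M = 0 the canvas kernel is empty, so the mild kernel is itself an error kernel and
  -- inherits its square integrability.
  have h := mildKernel_sub_canvasKernel hκ hκμ T 1 0 t x
  have h0 : canvasKernel T μ 1 0 t x = 0 := by simp [canvasKernel]
  rw [h0, sub_zero] at h
  rw [h]
  refine ⟨(measurable_errorKernel hκ hκμ T 1 0 t x).aestronglyMeasurable, ?_⟩
  refine (ENNReal.pow_lt_top_iff (n := 2) |>.1 ?_).resolve_right two_ne_zero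
  rw [eLpNorm_two_sq]
  exact (lintegral_errorKernel_sq_ne_top hT le_rfl hκ hκμ 0 ht x).lt_top

theorem IsMildSolution.lintegral_sub_sq (hT : 0 < T) (hN : 1 ≤ N) {κ : ℕ} (hκ : 1 ≤ κ)
    (hκμ : μ < (κ : ℝ) ^ 2 * Real.pi ^ 2) (hW : IsWhiteNoise T P W) {u : Ω → ℝ → ℝ → ℝ}
    (hu : IsMildSolution μ P W u) (M : ℕ) {t : ℝ} (ht : t ∈ Icc 0 T) {x : ℝ}
    (hx : x ∈ Icc (0 : ℝ) 1) :
    ∫⁻ ω, ENNReal.ofReal ((u ω t x - canvasField μ P W N M ω t x) ^ 2) ∂P =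
      ∑' k, ENNReal.ofReal (sineMode (k + 1) x ^ 2) *
        ENNReal.ofReal (lam (k + 1) ^ 2 * modeVariance T μ N M (k + 1) t) := by
  have h := (hW.isWienerIntegral (memLp_mildKernel hT hκ hκμ ht x)).sub hW
    (hW.isWienerIntegral_canvasField μ N M t x)
  rw [mildKernel_sub_canvasKernel hκ hκμ] at h
  have hiso := congrArg (· ^ 2) (h.eLpNorm_eq hW)
  simp only [eLpNorm_two_sq] at hiso
  rw [← lintegral_errorKernel_sq hT hN hκ hκμ M ht.2 x, ← hiso]
  refine lintegral_congr_ae ?_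
  filter_upwards [hu.eq_integral t ht x hx] with ω hω
  rw [hω]
  rfl

/-- Uniqueness replaces v by the explicit field almost surely, which also provides the joint
measurability needed to exchange the integrals over ω and x. For fixed x the isometry applies, and
ε_k² then integrates to 1. -/
theorem meanSquareError_eq [IsProbabilityMeasure P] (hT : 0 < T) (hN : 1 ≤ N) {κ : ℕ}
    (hκ : 1 ≤ κ) (hκμ : μ < (κ : ℝ) ^ 2 * Real.pi ^ 2) (hW : IsWhiteNoise T P W)
    {u v : Ω → ℝ → ℝ → ℝ} (hu : IsMildSolution μ P W u) (M : ℕ)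
    (hv : ∀ᵐ ω ∂P, IsCanvasSolution T μ N (canvasLoad P W N M ω) (v ω)) {t : ℝ}
    (ht : t ∈ Icc 0 T) :
    meanSquareError P u v t = ENNReal.ofReal √(errorSum T μ N M t) := by
  have h1 : ∫⁻ ω, (∫⁻ x in Ioo (0 : ℝ) 1, ENNReal.ofReal ((u ω t x - v ω t x) ^ 2)) ∂P =
      ∫⁻ ω, (∫⁻ x in Ioo (0 : ℝ) 1,
        ENNReal.ofReal ((u ω t x - canvasField μ P W N M ω t x) ^ 2)) ∂P := by
    refine lintegral_congr_ae ?_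
    filter_upwards [hv] with ω hω
    refine lintegral_congr_ae ?_
    filter_upwards [hω.ae_eq hT hN (isCanvasSolution_canvasField hT μ P W N M ω) ht] with x hx
    rw [hx]
  have hmeas : AEMeasurable (Function.uncurry fun (ω : Ω) (x : ℝ) =>
      ENNReal.ofReal ((u ω t x - canvasField μ P W N M ω t x) ^ 2))
      (P.prod (volume.restrict (Ioo 0 1))) :=
    (((hu.measurable t ht).sub (hW.aestronglyMeasurable_canvasField μ N M t)
      ).aemeasurable.pow_const 2).ennreal_ofReal
  have hsine : ∀ k, ∫⁻ x in Ioo (0 : ℝ) 1, ENNReal.ofReal (sineMode (k + 1) x ^ 2) = 1 :=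
    fun k => by
      have hi : IntegrableOn (fun x => sineMode (k + 1) x ^ 2) (Ioo 0 1) :=
        integrableOn_unit_of_continuous ((contDiff_sineMode (n := 0) (k + 1)).continuous.pow 2)
      rw [← ofReal_integral_eq_lintegral_ofReal hi (.of_forall fun _ => sq_nonneg _),
        integral_sineMode_sq, ENNReal.ofReal_one]
  have hsm : ∀ k, Measurable fun x => ENNReal.ofReal (sineMode (k + 1) x ^ 2) := fun k =>
    (((contDiff_sineMode (n := 0) (k + 1)).continuous.measurable).pow_const 2).ennreal_ofReal
  rw [meanSquareError, h1, lintegral_lintegral_swap hmeas,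
    setLIntegral_congr_fun measurableSet_Ioo fun x hx =>
      hu.lintegral_sub_sq hT hN hκ hκμ hW M ht (Ioo_subset_Icc_self hx),
    lintegral_tsum fun k => ((hsm k).mul_const _).aemeasurable]
  simp_rw [lintegral_mul_const _ (hsm _), hsine, one_mul]
  rw [← ENNReal.ofReal_tsum_of_nonneg (fun k => errorTerm_nonneg T μ N M k t)
    (summable_errorTerm hT hN hκ hκμ M ht)]
  change ENNReal.ofReal (errorSum T μ N M t) ^ (1 / 2 : ℝ) = _
  rw [ENNReal.ofReal_rpow_of_nonneg (errorSum_nonneg T μ N M t) (by norm_num), Real.sqrt_eq_rpow]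

end Representation

end CahnHilliardCook

end

/-! ### The error estimate. -/

theorem mainTheorem2 (T : ℝ) (hT : 0 < T) (μ : ℝ) (κ : ℕ) (hκ : 1 ≤ κ)
    (hκμ : μ < (κ : ℝ) ^ 2 * Real.pi ^ 2) :
    ∃ C : ℝ, 0 < C ∧
      ∀ {Ω : Type*} [MeasurableSpace Ω] (P : Measure Ω) [IsProbabilityMeasure P]
        (W : CahnHilliardCook.BorelPart T → Ω → ℝ) (_ : CahnHilliardCook.IsWhiteNoise T P W)
        (u : Ω → ℝ → ℝ → ℝ) (_ : CahnHilliardCook.IsMildSolution μ P W u)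
        (N M : ℕ) (_ : 1 ≤ N) (_ : κ ≤ M)
        (v : Ω → ℝ → ℝ → ℝ)
        (_ : ∀ᵐ ω ∂P, CahnHilliardCook.IsCanvasSolution T μ N
          (CahnHilliardCook.canvasLoad P W N M ω) (v ω)),
        ∃ m : ℝ≥0∞,
          IsGreatest (CahnHilliardCook.meanSquareError P u v '' Icc 0 T) m ∧
          m ≤ ENNReal.ofReal (C * ((T / N) ^ (1 / 8 : ℝ) + (M : ℝ) ^ (-(1 / 2) : ℝ))) := by
  -- The error equals a deterministic series, so the constant is fixed before the probability space
  -- and the noise.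
  obtain ⟨C, hC, hbound⟩ := CahnHilliardCook.exists_sqrt_errorSum_le hT hκ hκμ
  refine ⟨C, hC, ?_⟩
  intro Ω _ P _ W hW u hu N M hN hM v hv
  have heq := fun t (ht : t ∈ Icc 0 T) =>
    CahnHilliardCook.meanSquareError_eq hT hN hκ hκμ hW hu M hv ht
  obtain ⟨t₀, ht₀, hmax⟩ := isCompact_Icc.exists_isMaxOn (nonempty_Icc.2 hT.le)
    (CahnHilliardCook.continuousOn_errorSum hT hN hκ hκμ M)
  refine ⟨_, ⟨⟨t₀, ht₀, rfl⟩, ?_⟩, ?_⟩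
  · rintro _ ⟨t, ht, rfl⟩
    rw [heq t ht, heq t₀ ht₀]
    exact ENNReal.ofReal_le_ofReal (Real.sqrt_le_sqrt (hmax ht))
  · rw [heq t₀ ht₀]
    exact ENNReal.ofReal_le_ofReal (hbound N M hN (hκ.trans hM) t₀ ht₀)
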